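/- Let $n\ge 3$ and let $(X,d)$ be a metric space on $n$ points that are the leaves of a metric $n$-caterpillar tree. Here the $n$-caterpillar is the tree with leaves $x_1,\dots,x_n$ and inner vertices $y_1,\dots,y_{n-2}$ that form a path in this order, with $x_1$ attached to $y_1$, $x_n$ attached to $y_{n-2}$ and $x_{j+1}$ attached to $y_j$ for $1\le j\le n-2$; its edges carry arbitrary positive weights, and $d$ is the induced path metric on the set of leaves, identified with $X$. A split $\sigma=A|B$ of $X$ is an unordered partition of $X$ into two nonempty parts, and $\delta_\sigma(i,j)$ is $0$ if $i,j$ lie in the same part and $1$ otherwise. Two splits are compatible if some part of one is disjoint from some part of the other. There is a unique system $\mathcal S$ of pairwise compatible splits of $X$ for which there are weights $\alpha_\sigma>0$ with $d=\sum_{\sigma\in\mathcal S}\alpha_\sigma\delta_\sigma$. Let $\mathcal A(\mathcal S)$ be the arrangement of the hyperplanes $H_\sigma=\big(\tfrac{|B|}{n}\mathbb 1_A-\tfrac{|A|}{n}\mathbb 1_B\big)^{\perp}$, $\sigma=A|B\in\mathcal S$, in the space $\{x\in\mathbb R^X : \sum_i x_i=0\}$. Then the matroid of $\mathcal A(\mathcal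 S)$ (linear independence of the normal vectors) is isomorphic to the graphic (cycle) matroid of the graph $\mathcal G_n$ on $n$ vertices that consists of a path on $n-1$ vertices and one further vertex joined to all vertices of the path. Moreover, the Lipschitz polytope $$\operatorname{LIP}(X,d)=\Big\{x\in\mathbb R^X : \sum_i x_i=0,\ x_i-x_j\le d(i,j)\ \text{for all } i,j\in X\Big\}$$ has exactly $2\cdot 3^{n-2}$ vertices, and the fundamental polytope $$P_d(X)=\operatorname{conv}\Big\{\frac{\mathbb 1_i-\mathbb 1_j}{d(i,j)} : i,j\in X,\ i\ne j\Big\}$$ has exactly $2\cdot 3^{n-2}$ facets. -/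

import Mathlib

/-! ### Polytopes of a finite metric space -/

/-- The fundamental polytope `P_d(X)`: the convex hull of the points
`(1_i - 1_j) / d(i, j)` for `i ≠ j`. -/
def fundamentalPolytope (X : Type*) [MetricSpace X] : Set (X → ℝ) :=
  convexHull ℝ {e | ∃ i j : X, i ≠ j ∧
    e = (dist i j)⁻¹ • (Set.indicator {i} (1 : X → ℝ) - Set.indicator {j} (1 : X → ℝ))}

/-- The Lipschitz polytope `LIP(X, d)`. -/
def lipschitzPolytope (X : Type*) [Fintype X] [PseudoMetricSpace X] : Set (X → ℝ) :=
  {x | ∑ i, x i = 0 ∧ ∀ i j, x i - x j ≤ dist i j}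

open Classical in
/-- The dimension of a convex set, with the convention that the empty set has dimension `-1`. -/
noncomputable def convexDim {E : Type*} [AddCommGroup E] [Module ℝ E] (P : Set E) : ℤ :=
  if P.Nonempty then (Module.finrank ℝ (vectorSpan ℝ P) : ℤ) else -1

/-- The number of `i`-dimensional faces of a polytope `P`. A face is a subset of `P` that is
empty or the set of maximisers over `P` of some linear functional. -/
noncomputable def faceNumber {E : Type*} [AddCommGroup E] [Module ℝ E] [TopologicalSpace E]
    (P : Set E) (i : ℤ) : ℕ :=
  {F : Set E | IsExposed ℝ P F ∧ convexDim F = i}.ncard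

/-- The number of vertices (`0`-dimensional faces). -/
noncomputable def numVertices {E : Type*} [AddCommGroup E] [Module ℝ E] [TopologicalSpace E]
    (P : Set E) : ℕ :=
  faceNumber P 0

/-- The number of facets (faces of codimension `1` in `P`). -/
noncomputable def numFacets {E : Type*} [AddCommGroup E] [Module ℝ E] [TopologicalSpace E]
    (P : Set E) : ℕ :=
  faceNumber P (convexDim P - 1)

/-! ### Split systems -/

/-- A split `A | Aᶜ` of `X`: an unordered bipartition of `X` into two nonempty sides. -/
def Split (X : Type*) : Type _ :=
  {σ : Sym2 (Set X) // ∃ A : Set X, A.Nonempty ∧ Aᶜ.Nonempty ∧ σ = s(A, Aᶜ)}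

namespace Split

/-- `A` is one of the two sides of `σ`. -/
def IsSide {X : Type*} (σ : Split X) (A : Set X) : Prop := A ∈ σ.1

open Classical in
/-- The function `δ_σ`: `0` on pairs on the same side of `σ`, `1` on separated pairs. -/
noncomputable def delta {X : Type*} (σ : Split X) (i j : X) : ℝ :=
  if ∃ A, σ.IsSide A ∧ i ∈ A ∧ j ∈ A then 0 else 1

/-- Two splits are compatible if some side of one is disjoint from some side of the other. -/
def Compatible {X : Type*} (σ τ : Split X) : Prop :=
  ∃ A B, σ.IsSide A ∧ τ.IsSide B ∧ A ∩ B = ∅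

/-- The vector `(|Aᶜ| / n) 1_A - (|A| / n) 1_{Aᶜ}`, where `n = |X|`. -/
noncomputable def sideVec {X : Type*} (A : Set X) : X → ℝ :=
  ((Aᶜ.ncard : ℝ) / (Nat.card X : ℝ)) • A.indicator (1 : X → ℝ) -
    ((A.ncard : ℝ) / (Nat.card X : ℝ)) • Aᶜ.indicator (1 : X → ℝ)

/-- The segment `S_σ`; its end points are the vectors of the two sides of `σ`. -/
def segment {X : Type*} (σ : Split X) : Set (X → ℝ) :=
  convexHull ℝ {v | ∃ A, σ.IsSide A ∧ v = sideVec A}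

/-- The orthogonal complement `(S_σ)^⊥` in `ℝ^X`. -/
def hyperplane {X : Type*} [Fintype X] (σ : Split X) : Submodule ℝ (X → ℝ) where
  carrier := {x | ∀ y ∈ σ.segment, x ⬝ᵥ y = 0}
  add_mem' := by
    intro a b ha hb y hy
    rw [add_dotProduct, ha y hy, hb y hy, add_zero]
  zero_mem' := by
    intro y _
    exact zero_dotProduct y
  smul_mem' := by
    intro c a ha y hy
    rw [smul_dotProduct, ha y hy, smul_zero]

end Split

/-- `S` is a system of pairwise compatible splits with positive weights `α` for which
`d = ∑_{σ ∈ S} α_σ δ_σ`. -/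
def IsSplitDecomposition (X : Type*) [PseudoMetricSpace X] (S : Finset (Split X)) : Prop :=
  (∀ σ ∈ S, ∀ τ ∈ S, σ.Compatible τ) ∧
    ∃ α : Split X → ℝ, (∀ σ ∈ S, 0 < α σ) ∧
      ∀ x y : X, dist x y = ∑ σ ∈ S, α σ * σ.delta x y

/-- The ambient space `V(S)`: vectors with coordinate sum `0` that agree on any two points
separated by no split of `S`. -/
def splitSpace {X : Type*} [Fintype X] (S : Finset (Split X)) : Submodule ℝ (X → ℝ) where
  carrier := {x | ∑ i, x i = 0 ∧ ∀ i j, (∀ σ ∈ S, σ.delta i j = 0) → x i = x j}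
  add_mem' := by
    rintro a b ⟨ha, ha'⟩ ⟨hb, hb'⟩
    refine ⟨?_, fun i j h => ?_⟩
    · simp [Finset.sum_add_distrib, ha, hb]
    · simp [ha' i j h, hb' i j h]
  zero_mem' := by simp
  smul_mem' := by
    rintro c a ⟨ha, ha'⟩
    refine ⟨?_, fun i j h => ?_⟩
    · simp [← Finset.mul_sum, ha]
    · simp [ha' i j h]

open Classical in
/-- The arrangement `A(S)` of the hyperplanes `H_σ`, `σ ∈ S`, in the space `V(S)`. -/
noncomputable def splitArrangement {X : Type*} [Fintype X] (S : Finset (Split X)) :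
    Finset (Submodule ℝ (splitSpace S)) :=
  S.image fun σ => σ.hyperplane.comap (splitSpace S).subtype

/-! ### Matroids -/

/-- Two matroids are isomorphic if there is a bijection of their ground sets that preserves
independence in both directions. -/
def MatroidIso {α β : Type*} (M : Matroid α) (N : Matroid β) : Prop :=
  ∃ e : M.E ≃ N.E, ∀ I : Set M.E,
    M.Indep (Subtype.val '' I) ↔ N.Indep (Subtype.val '' (e '' I))

open Classical in
/-- A normal covector of a hyperplane `H`, that is a nonzero functional with kernel `H`
(it is unique up to a nonzero factor); `0` if `H` is not a hyperplane. -/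
noncomputable def normalCovector {V : Type*} [AddCommGroup V] [Module ℝ V]
    (H : Submodule ℝ V) : Module.Dual ℝ V :=
  if h : ∃ f : Module.Dual ℝ V, f ≠ 0 ∧ LinearMap.ker f = H then h.choose else 0

theorem linearIndepOn_augment {K W ι : Type*} [DivisionRing K] [AddCommGroup W] [Module K W]
    {v : ι → W} {I J : Set ι} (hfI : I.Finite) (hfJ : J.Finite)
    (hJ : LinearIndepOn K v J) (hlt : I.ncard < J.ncard) :
    ∃ e ∈ J, v e ∉ Submodule.span K (v '' I) := by
  by_contra! hcon
  have hle : Submodule.span K (v '' J) ≤ Submodule.span K (v '' I) := by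
    rw [Submodule.span_le]
    rintro _ ⟨e, he, rfl⟩
    exact hcon e he
  have : FiniteDimensional K (Submodule.span K (v '' I)) :=
    FiniteDimensional.span_of_finite K (hfI.image v)
  have := hfI.fintype
  have := hfJ.fintype
  have h1 : Module.finrank K (Submodule.span K (v '' J)) = J.ncard := by
    rw [Set.image_eq_range, finrank_span_eq_card hJ, ← Nat.card_eq_fintype_card,
      Nat.card_coe_set_eq]
  have h2 : Module.finrank K (Submodule.span K (v '' I)) ≤ I.ncard := by
    rw [Set.image_eq_range]
    refine (finrank_range_le_card (R := K) (fun i : I => v i)).trans ?_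
    rw [← Nat.card_eq_fintype_card, Nat.card_coe_set_eq]
  have h3 := Submodule.finrank_mono hle
  omega

/-- The matroid of a hyperplane arrangement: its elements are the hyperplanes, and a set of
hyperplanes is independent if their normal covectors are linearly independent. -/
noncomputable def arrangementMatroid {V : Type*} [AddCommGroup V] [Module ℝ V]
    (𝒜 : Finset (Submodule ℝ V)) : Matroid (Submodule ℝ V) :=
  (IndepMatroid.ofFinite (E := (𝒜 : Set (Submodule ℝ V))) 𝒜.finite_toSet
    (fun I => I ⊆ (𝒜 : Set (Submodule ℝ V)) ∧ LinearIndepOn ℝ normalCovector I)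
    ⟨Set.empty_subset _, linearIndepOn_empty ℝ _⟩
    (fun _ _ hJ hIJ => ⟨hIJ.trans hJ.1, hJ.2.mono hIJ⟩)
    (by
      intro I J hI hJ hlt
      obtain ⟨e, heJ, he⟩ := linearIndepOn_augment (𝒜.finite_toSet.subset hI.1)
        (𝒜.finite_toSet.subset hJ.1) hJ.2 hlt
      exact ⟨e, heJ, fun h => he (Submodule.subset_span ⟨e, h, rfl⟩),
        Set.insert_subset (hJ.1 heJ) hI.1, hI.2.insert he⟩)
    (fun _ hI => hI.1)).matroid

/-- The vector over the two-element field attached to an edge; used only to check the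
augmentation axiom for forests. -/
noncomputable def edgeVec {V : Type*} : Sym2 V → (V →₀ ZMod 2) :=
  Sym2.lift ⟨fun u v => Finsupp.single u 1 + Finsupp.single v 1, fun _ _ => add_comm _ _⟩

theorem edgeVec_mem_span_of_reachable {V : Type*} {I : Set (Sym2 V)} {u v : V}
    (h : (SimpleGraph.fromEdgeSet I).Reachable u v) :
    edgeVec s(u, v) ∈ Submodule.span (ZMod 2) (edgeVec '' I) := by
  obtain ⟨p⟩ := h
  induction p with
  | nil =>
    rename_i u
    have h0 : edgeVec s(u, u) = 0 := by
      change Finsupp.single u (1 : ZMod 2) + Finsupp.single u 1 = 0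
      rw [← Finsupp.single_add, CharTwo.add_self_eq_zero, Finsupp.single_zero]
    rw [h0]
    exact Submodule.zero_mem _
  | cons h p ih =>
    rename_i a b c
    have hab : s(a, b) ∈ I := ((SimpleGraph.fromEdgeSet_adj I).1 h).1
    have h1 : edgeVec s(a, c) = edgeVec s(a, b) + edgeVec s(b, c) := by
      change Finsupp.single a (1 : ZMod 2) + Finsupp.single c 1 =
        (Finsupp.single a 1 + Finsupp.single b 1) + (Finsupp.single b 1 + Finsupp.single c 1)
      have h2 : Finsupp.single b (1 : ZMod 2) + Finsupp.single b 1 = 0 := by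
        rw [← Finsupp.single_add, CharTwo.add_self_eq_zero, Finsupp.single_zero]
      rw [add_assoc, ← add_assoc (Finsupp.single b (1 : ZMod 2)), h2, zero_add]
    rw [h1]
    exact Submodule.add_mem _ (Submodule.subset_span ⟨_, hab, rfl⟩) ih

open Classical in
theorem edgeVec_notMem_span {V : Type*} {I : Set (Sym2 V)} {u v : V}
    (h : ¬ (SimpleGraph.fromEdgeSet I).Reachable u v) :
    edgeVec s(u, v) ∉ Submodule.span (ZMod 2) (edgeVec '' I) := by
  intro hmem
  let φ : (V →₀ ZMod 2) →ₗ[ZMod 2] ZMod 2 := Finsupp.linearCombination (ZMod 2)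
    fun x => if (SimpleGraph.fromEdgeSet I).Reachable u x then (1 : ZMod 2) else 0
  have hφ : ∀ a b, φ (edgeVec s(a, b)) =
      (if (SimpleGraph.fromEdgeSet I).Reachable u a then (1 : ZMod 2) else 0) +
        if (SimpleGraph.fromEdgeSet I).Reachable u b then (1 : ZMod 2) else 0 := by
    intro a b
    change φ (Finsupp.single a (1 : ZMod 2) + Finsupp.single b 1) = _
    simp [φ]
  have hle : Submodule.span (ZMod 2) (edgeVec '' I) ≤ LinearMap.ker φ := by
    rw [Submodule.span_le]
    rintro _ ⟨e, he, rfl⟩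
    induction e using Sym2.ind with
    | _ a b =>
      change φ (edgeVec s(a, b)) = 0
      rw [hφ]
      by_cases hab : a = b
      · subst hab
        exact CharTwo.add_self_eq_zero _
      have hadj : (SimpleGraph.fromEdgeSet I).Adj a b :=
        (SimpleGraph.fromEdgeSet_adj I).2 ⟨he, hab⟩
      have hiff : (SimpleGraph.fromEdgeSet I).Reachable u a ↔
          (SimpleGraph.fromEdgeSet I).Reachable u b :=
        ⟨fun h => h.trans hadj.reachable, fun h => h.trans hadj.symm.reachable⟩
      simp only [hiff]
      exact CharTwo.add_self_eq_zero _
  have h0 : φ (edgeVec s(u, v)) = 0 := hle hmem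
  rw [hφ, if_pos (SimpleGraph.Reachable.refl u), if_neg h, add_zero] at h0
  exact one_ne_zero h0

theorem fromEdgeSet_insert_eq {V : Type*} (I : Set (Sym2 V)) (u v : V) :
    SimpleGraph.fromEdgeSet (insert s(u, v) I) =
      SimpleGraph.fromEdgeSet I ⊔ SimpleGraph.edge u v := by
  ext a b
  simp only [SimpleGraph.edge, SimpleGraph.sup_adj, SimpleGraph.fromEdgeSet_adj,
    Set.mem_insert_iff, Set.mem_singleton_iff]
  tauto

theorem linearIndepOn_edgeVec {V : Type*} {I : Set (Sym2 V)} (hfin : I.Finite)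
    (hloop : ∀ u, s(u, u) ∉ I) (hI : (SimpleGraph.fromEdgeSet I).IsAcyclic) :
    LinearIndepOn (ZMod 2) edgeVec I := by
  induction I, hfin using Set.Finite.induction_on with
  | empty => exact linearIndepOn_empty _ _
  | @insert e I he _ ih =>
    induction e using Sym2.ind with
    | _ u v =>
      rw [fromEdgeSet_insert_eq, SimpleGraph.isAcyclic_sup_fromEdgeSet_iff] at hI
      refine (ih (fun w hw => hloop w (Set.mem_insert_of_mem _ hw)) hI.1).insert
        (edgeVec_notMem_span fun hr => ?_)
      rcases hI.2 hr with h | h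
      · subst h
        exact hloop u (Set.mem_insert _ _)
      · exact he ((SimpleGraph.fromEdgeSet_adj I).1 h).1

/-- The graphic (cycle) matroid of a finite graph: its elements are the edges, and a set of edges
is independent if it contains no cycle. -/
def cycleMatroid {V : Type*} [Finite V] (G : SimpleGraph V) : Matroid (Sym2 V) :=
  (IndepMatroid.ofFinite (E := G.edgeSet) (Set.toFinite _)
    (fun I => I ⊆ G.edgeSet ∧ (SimpleGraph.fromEdgeSet I).IsAcyclic)
    ⟨Set.empty_subset _, by
      rw [SimpleGraph.fromEdgeSet_empty]
      exact SimpleGraph.isAcyclic_bot⟩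
    (fun _ _ hJ hIJ => ⟨hIJ.trans hJ.1, hJ.2.anti (SimpleGraph.fromEdgeSet_mono hIJ)⟩)
    (by
      intro I J hI hJ hlt
      have hJind : LinearIndepOn (ZMod 2) edgeVec J :=
        linearIndepOn_edgeVec (Set.toFinite _) (fun u hu => G.loopless.irrefl u (hJ.1 hu)) hJ.2
      obtain ⟨e, heJ, he⟩ := linearIndepOn_augment (Set.toFinite I) (Set.toFinite J) hJind hlt
      refine ⟨e, heJ, fun h => he (Submodule.subset_span ⟨e, h, rfl⟩),
        Set.insert_subset (hJ.1 heJ) hI.1, ?_⟩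
      induction e using Sym2.ind with
      | _ u v =>
        rw [fromEdgeSet_insert_eq]
        exact SimpleGraph.IsAcyclic.sup_edge_of_not_reachable
          (fun hr => he (edgeVec_mem_span_of_reachable hr)) hI.2)
    (fun _ hI => hI.1)).matroid

/-! ### Caterpillar metrics and the graph `G_n` -/

/-- The path metric of a graph `G` with edge weights `w`: the least total weight of a walk. -/
noncomputable def weightedDist {V : Type*} (G : SimpleGraph V) (w : Sym2 V → ℝ) (u v : V) : ℝ :=
  sInf (Set.range fun p : G.Walk u v => (p.edges.map w).sum)

/-- The `n`-caterpillar tree (for `n ≥ 3`): leaves `x_0, …, x_{n-1}` (left summand) and inner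
vertices `y_0, …, y_{n-3}` (right summand). The inner vertices form a path in this order; `x_0` is
attached to `y_0`, `x_{n-1}` to `y_{n-3}`, and `x_{j+1}` to `y_j` for every `j`. -/
def caterpillar (n : ℕ) : SimpleGraph (Fin n ⊕ Fin (n - 2)) :=
  SimpleGraph.fromRel fun a b =>
    match a, b with
    | .inl i, .inr j =>
        i.val = j.val + 1 ∨ (i.val = 0 ∧ j.val = 0) ∨ (i.val + 1 = n ∧ j.val + 3 = n)
    | .inr j, .inr k => j.val + 1 = k.val
    | _, _ => False

/-- `X` is the set of leaves of an `n`-caterpillar tree with positive edge weights, with the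
induced metric. -/
def IsCaterpillarMetric (n : ℕ) (X : Type*) [PseudoMetricSpace X] : Prop :=
  ∃ (φ : X ≃ Fin n) (w : Sym2 (Fin n ⊕ Fin (n - 2)) → ℝ),
    (∀ e ∈ (caterpillar n).edgeSet, 0 < w e) ∧
      ∀ x y : X, dist x y = weightedDist (caterpillar n) w (.inl (φ x)) (.inl (φ y))

/-- The graph `G_n` on `n` vertices: an apex (the vertex `0`) joined to all the vertices of a path
with the `n - 1` vertices `1, …, n - 1`. -/
def fanGraph (n : ℕ) : SimpleGraph (Fin n) :=
  SimpleGraph.fromRel fun i j => i.val = 0 ∨ i.val + 1 = j.val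

/-! ### Vertices of the Lipschitz polytope and facets of the fundamental polytope -/

/-! Write n = m + 2. The path joining the two end leaves has m + 1 edges, and the other m leaves
hang from it by one leg each. Every edge of the tree cuts the leaves in two, and d is the sum of the
resulting cut metrics weighted by edge length (`CaterpillarData.dist_eq_sum`). This gives the split
system. It is unique because a split belongs to a decomposition exactly if its sides satisfy strict
four-point inequalities, which involve only d (`IsSplitDecomposition.mem_iff`).

On vectors with coordinate sum 0, the normal of a split is the functional "sum over one side". Let s
k be the sum of the first k coordinates. A path edge then gives s (k + 1) - s 0 and a leg gives s (k
+ 2) - s (k + 1). These are the potential differences along the spokes and the rim edges of the fan,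
and the potentials are arbitrary up to a constant. Such differences are independent exactly if the
edges form a forest (`linearIndepOn_sub_iff_isAcyclic`), whence the matroid isomorphism.

A Lipschitz function on the leaves extends to the inner vertices, and its increments along the edges
are then bounded by the edge lengths and otherwise free. So the Lipschitz polytope is the zonotope
generated by the weighted split vectors (`CaterpillarData.lipschitzPolytope_eq_zonotope`). Its
vertices correspond to the regions of the fan arrangement, that is, to acyclic orientations of the
fan: two choices for the first spoke and three for each further triangle, so 2 * 3 ^ m in all
(`card_fanOrientation`).

The fundamental polytope is polar to the Lipschitz polytope, so its facets correspond to the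
vertices already counted (`numFacets_fundamentalPolytope`). -/

theorem convexDim_eq_zero_iff {E : Type*} [AddCommGroup E] [Module ℝ E] [FiniteDimensional ℝ E]
    {P : Set E} : convexDim P = 0 ↔ ∃ x, P = {x} := by
  unfold convexDim
  constructor
  · intro h
    split_ifs at h with hP
    obtain ⟨x, hx⟩ := hP
    have h1 : vectorSpan ℝ P = ⊥ := Submodule.finrank_eq_zero.1 (by exact_mod_cast h)
    refine ⟨x, Set.eq_singleton_iff_unique_mem.2 ⟨hx, fun y hy => ?_⟩⟩
    have h2 : y -ᵥ x ∈ vectorSpan ℝ P := vsub_mem_vectorSpan ℝ hy hx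
    rw [h1, Submodule.mem_bot] at h2
    exact vsub_eq_zero_iff_eq.1 h2
  · rintro ⟨x, rfl⟩
    simp

theorem numVertices_eq_ncard_exposedPoints {E : Type*} [AddCommGroup E] [Module ℝ E]
    [TopologicalSpace E] [FiniteDimensional ℝ E] (P : Set E) :
    numVertices P = (P.exposedPoints ℝ).ncard := by
  rw [← Set.ncard_image_of_injective (P.exposedPoints ℝ) Set.singleton_injective]
  unfold numVertices faceNumber
  congr 1
  ext F
  simp only [Set.mem_ofPred_eq, convexDim_eq_zero_iff, Set.mem_image,
    mem_exposedPoints_iff_exposed_singleton]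
  constructor
  · rintro ⟨h, x, rfl⟩
    exact ⟨x, h, rfl⟩
  · rintro ⟨x, h, rfl⟩
    exact ⟨h, x, rfl⟩

/-- If an affine functional is constant equal to `1` on a set, its linear span has one dimension
more than its affine span. -/
theorem finrank_span_eq_finrank_vectorSpan_add_one {E : Type*} [AddCommGroup E] [Module ℝ E]
    [FiniteDimensional ℝ E] {F : Set E} (hF : F.Nonempty) (l : Module.Dual ℝ E)
    (hl : ∀ f ∈ F, l f = 1) :
    Module.finrank ℝ (Submodule.span ℝ F) = Module.finrank ℝ (vectorSpan ℝ F) + 1 := by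
  obtain ⟨f₀, hf₀⟩ := hF
  have hker : vectorSpan ℝ F ≤ LinearMap.ker l := by
    rw [vectorSpan_def, Submodule.span_le]
    rintro _ ⟨a, ha, b, hb, rfl⟩
    simp [hl a ha, hl b hb]
  have hspan : Submodule.span ℝ F = vectorSpan ℝ F ⊔ Submodule.span ℝ {f₀} := by
    apply le_antisymm
    · rw [Submodule.span_le]
      intro f hf
      have h1 : f = (f -ᵥ f₀) + f₀ := by simp
      rw [h1]
      exact Submodule.add_mem_sup (vsub_mem_vectorSpan ℝ hf hf₀)
        (Submodule.mem_span_singleton_self f₀)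
    · refine sup_le ?_ ?_
      · rw [vectorSpan_def, Submodule.span_le]
        rintro _ ⟨a, ha, b, hb, rfl⟩
        exact Submodule.sub_mem _ (Submodule.subset_span ha) (Submodule.subset_span hb)
      · rw [Submodule.span_le, Set.singleton_subset_iff]
        exact Submodule.subset_span hf₀
  have hinf : vectorSpan ℝ F ⊓ Submodule.span ℝ {f₀} = ⊥ := by
    rw [eq_bot_iff]
    rintro x ⟨hx, hx'⟩
    obtain ⟨c, rfl⟩ := Submodule.mem_span_singleton.1 hx'
    have h1 : l (c • f₀) = 0 := hker hx
    rw [map_smul, hl f₀ hf₀, smul_eq_mul, mul_one] at h1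
    simp [h1]
  have hne : f₀ ≠ 0 := by
    rintro rfl
    simpa using hl 0 hf₀
  have h2 := Submodule.finrank_sup_add_finrank_inf_eq (vectorSpan ℝ F) (Submodule.span ℝ {f₀})
  rw [hinf, finrank_bot, finrank_span_singleton hne] at h2
  rw [hspan]
  omega

/-- The vectors with coordinate sum `0`. -/
def sumZero (X : Type*) [Fintype X] : Submodule ℝ (X → ℝ) :=
  LinearMap.ker (∑ i, LinearMap.proj i : (X → ℝ) →ₗ[ℝ] ℝ)

theorem mem_sumZero {X : Type*} [Fintype X] {x : X → ℝ} : x ∈ sumZero X ↔ ∑ i, x i = 0 := by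
  simp [sumZero]

theorem finrank_sumZero (X : Type*) [Fintype X] [Nonempty X] :
    Module.finrank ℝ (sumZero X) + 1 = Fintype.card X := by
  have h := LinearMap.finrank_range_add_finrank_ker
    (∑ i, LinearMap.proj i : (X → ℝ) →ₗ[ℝ] ℝ)
  have h1 : LinearMap.range (∑ i, LinearMap.proj i : (X → ℝ) →ₗ[ℝ] ℝ) = ⊤ := by
    classical
    rw [LinearMap.range_eq_top]
    intro c
    obtain ⟨i⟩ := ‹Nonempty X›
    exact ⟨Pi.single i c, by simp⟩
  rw [h1, finrank_top, Module.finrank_self, Module.finrank_fintype_fun_eq_card] at h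
  unfold sumZero
  omega

/-- The linear functional `x ↦ c ⬝ᵥ x`. -/
noncomputable def dotFunctional {X : Type*} [Fintype X] (c : X → ℝ) : (X → ℝ) →L[ℝ] ℝ :=
  LinearMap.toContinuousLinearMap (dotProductBilin ℝ ℝ c)

@[simp]
theorem dotFunctional_apply {X : Type*} [Fintype X] (c x : X → ℝ) :
    dotFunctional c x = c ⬝ᵥ x := rfl

theorem exists_eq_dotFunctional {X : Type*} [Fintype X] (l : (X → ℝ) →L[ℝ] ℝ) :
    ∃ c, l = dotFunctional c := by
  classical
  refine ⟨fun i => l (Pi.single i 1), ContinuousLinearMap.ext fun x => ?_⟩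
  conv_lhs => rw [pi_eq_sum_univ' x]
  simp [dotProduct, mul_comm]

/-- The generators of the fundamental polytope. -/
noncomputable def elementaryVec {X : Type*} [MetricSpace X] (i j : X) : X → ℝ :=
  (dist i j)⁻¹ • (Set.indicator {i} (1 : X → ℝ) - Set.indicator {j} (1 : X → ℝ))

theorem elementaryVec_mem {X : Type*} [MetricSpace X] {i j : X} (h : i ≠ j) : elementaryVec i j ∈ fundamentalPolytope X :=
  subset_convexHull ℝ _ ⟨i, j, h, rfl⟩

theorem elementaryVec_swap {X : Type*} [MetricSpace X] (i j : X) : elementaryVec j i = -elementaryVec i j := by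
  rw [elementaryVec, elementaryVec, dist_comm, ← smul_neg, neg_sub]

/-- A proper subspace of the sum-zero space has a nonzero orthogonal vector in that space. -/
theorem eq_sumZero_of_forall_orthogonal {X : Type*} [Fintype X] {U : Submodule ℝ (X → ℝ)} (hU : U ≤ sumZero X)
    (h : ∀ w ∈ sumZero X, (∀ u ∈ U, w ⬝ᵥ u = 0) → w = 0) : U = sumZero X := by
  by_contra hne
  have hlt : Module.finrank ℝ U < Module.finrank ℝ (sumZero X) :=
    Submodule.finrank_lt_finrank_of_lt (lt_of_le_of_ne hU hne)
  -- Pairing with U maps the sum-zero space to a dual of smaller dimension, so it has a nonzero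
  -- kernel.
  let T : sumZero X →ₗ[ℝ] Module.Dual ℝ U :=
    (Module.Dual.transpose (R := ℝ) U.subtype) ∘ₗ (dotProductBilin ℝ ℝ) ∘ₗ (sumZero X).subtype
  have hker : LinearMap.ker T ≠ ⊥ :=
    LinearMap.ker_ne_bot_of_finrank_lt (by rwa [Subspace.dual_finrank_eq])
  obtain ⟨w, hw, hw0⟩ := Submodule.exists_mem_ne_zero_of_ne_bot hker
  refine hw0 (Subtype.ext (h w w.2 fun u hu => ?_))
  exact LinearMap.congr_fun (LinearMap.mem_ker.1 hw) ⟨u, hu⟩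

/-! ### Polarity of the two polytopes inside the sum-zero space -/

section Duality

variable {X : Type*} [Fintype X] [MetricSpace X]

theorem dotProduct_elementaryVec (x : X → ℝ) (i j : X) :
    x ⬝ᵥ elementaryVec i j = (dist i j)⁻¹ * (x i - x j) := by
  classical
  have h : ∀ k : X, Set.indicator {k} (1 : X → ℝ) = Pi.single k 1 := fun k => by
    ext x
    simp
  rw [elementaryVec, dotProduct_smul, dotProduct_sub, smul_eq_mul, h, h, dotProduct_single_one,
    dotProduct_single_one]

theorem dotProduct_elementaryVec_le_one_iff (x : X → ℝ) {i j : X} (h : i ≠ j) :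
    x ⬝ᵥ elementaryVec i j ≤ 1 ↔ x i - x j ≤ dist i j := by
  rw [dotProduct_elementaryVec, inv_mul_le_iff₀ (dist_pos.2 h), mul_one]

theorem dotProduct_elementaryVec_eq_one_iff (x : X → ℝ) {i j : X} (h : i ≠ j) :
    x ⬝ᵥ elementaryVec i j = 1 ↔ x i - x j = dist i j := by
  rw [dotProduct_elementaryVec, inv_mul_eq_iff_eq_mul₀ (dist_pos.2 h).ne', mul_one]

theorem dotProduct_le_of_forall_elementaryVec {x : X → ℝ} {c : ℝ}
    (h : ∀ i j : X, i ≠ j → x ⬝ᵥ elementaryVec i j ≤ c) {e : X → ℝ}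
    (he : e ∈ fundamentalPolytope X) : x ⬝ᵥ e ≤ c := by
  have hsub : fundamentalPolytope X ⊆ {e | dotFunctional x e ≤ c} := by
    refine convexHull_min ?_ (convex_halfSpace_le (dotFunctional x).toLinearMap.isLinear c)
    rintro _ ⟨i, j, hij, rfl⟩
    exact h i j hij
  exact hsub he

theorem dotProduct_le_one {x : X → ℝ} (hx : x ∈ lipschitzPolytope X) {e : X → ℝ}
    (he : e ∈ fundamentalPolytope X) : x ⬝ᵥ e ≤ 1 :=
  dotProduct_le_of_forall_elementaryVec
    (fun _ _ h => (dotProduct_elementaryVec_le_one_iff x h).2 (hx.2 _ _)) he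

theorem mem_lipschitzPolytope_iff {x : X → ℝ} :
    x ∈ lipschitzPolytope X ↔ x ∈ sumZero X ∧ ∀ e ∈ fundamentalPolytope X, x ⬝ᵥ e ≤ 1 := by
  refine ⟨fun h => ⟨mem_sumZero.2 h.1, fun e he => dotProduct_le_one h he⟩, fun h =>
    ⟨mem_sumZero.1 h.1, fun i j => ?_⟩⟩
  rcases eq_or_ne i j with rfl | hij
  · simp
  · exact (dotProduct_elementaryVec_le_one_iff x hij).1 (h.2 _ (elementaryVec_mem hij))

theorem elementaryVec_mem_sumZero (i j : X) : elementaryVec i j ∈ sumZero X := by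
  classical
  refine Submodule.smul_mem _ _ ?_
  simp [mem_sumZero, Finset.sum_sub_distrib]

theorem fundamentalPolytope_subset_sumZero : fundamentalPolytope X ⊆ sumZero X := by
  refine convexHull_min ?_ (sumZero X).convex
  rintro _ ⟨i, j, -, rfl⟩
  exact elementaryVec_mem_sumZero i j

theorem eq_zero_of_forall_dotProduct_elementaryVec {x : X → ℝ} (hx : x ∈ sumZero X)
    (h : ∀ i j : X, i ≠ j → x ⬝ᵥ elementaryVec i j = 0) : x = 0 := by
  ext i
  have h1 : ∀ j, x j = x i := by
    intro j
    rcases eq_or_ne j i with rfl | hij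
    · rfl
    · have := h j i hij
      rw [dotProduct_elementaryVec, mul_eq_zero, inv_eq_zero] at this
      exact sub_eq_zero.1 (this.resolve_left (dist_pos.2 hij).ne')
  have h2 := mem_sumZero.1 hx
  rw [Finset.sum_congr rfl fun j _ => h1 j, Finset.sum_const, Finset.card_univ, nsmul_eq_mul,
    mul_eq_zero] at h2
  rcases h2 with h2 | h2
  · have : Fintype.card X = 0 := by exact_mod_cast h2
    exact ((Fintype.card_eq_zero_iff.1 this).false i).elim
  · exact h2

/-- Generators come in opposite pairs, so the differences already contain twice every generator. -/
theorem vectorSpan_fundamentalPolytope : vectorSpan ℝ (fundamentalPolytope X) = sumZero X := by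
  apply eq_sumZero_of_forall_orthogonal
  · rw [vectorSpan_def, Submodule.span_le]
    rintro _ ⟨a, ha, b, hb, rfl⟩
    exact Submodule.sub_mem _ (fundamentalPolytope_subset_sumZero ha)
      (fundamentalPolytope_subset_sumZero hb)
  · intro w hw h
    refine eq_zero_of_forall_dotProduct_elementaryVec hw fun i j hij => ?_
    have h1 := h _ (vsub_mem_vectorSpan ℝ (elementaryVec_mem hij) (elementaryVec_mem hij.symm))
    rw [elementaryVec_swap i j, vsub_eq_sub, sub_neg_eq_add, dotProduct_add] at h1
    linarith

variable (X) in
theorem convexDim_fundamentalPolytope [Nontrivial X] :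
    convexDim (fundamentalPolytope X) + 1 = Fintype.card X := by
  obtain ⟨i, j, hij⟩ := exists_pair_ne X
  rw [convexDim, if_pos ⟨_, elementaryVec_mem hij⟩, vectorSpan_fundamentalPolytope]
  exact_mod_cast finrank_sumZero X

/-- The face of the fundamental polytope that is dual to a point of the Lipschitz polytope. -/
def dualFace (v : X → ℝ) : Set (X → ℝ) :=
  {e | e ∈ fundamentalPolytope X ∧ v ⬝ᵥ e = 1}

/-- If w is orthogonal to all constraints tight at v, then v can be moved a little along w in both
directions without leaving the polytope. At a vertex this forces w = 0. -/
theorem span_dualFace {v : X → ℝ} (hv : v ∈ (lipschitzPolytope X).exposedPoints ℝ) :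
    Submodule.span ℝ (dualFace v) = sumZero X := by
  obtain ⟨hvL, l, hl⟩ := hv
  apply eq_sumZero_of_forall_orthogonal
  · rw [Submodule.span_le]
    exact fun e he => fundamentalPolytope_subset_sumZero he.1
  intro w hw h
  have hev : ∀ᶠ ε : ℝ in nhds 0, ∀ i j, (v + ε • w) i - (v + ε • w) j ≤ dist i j := by
    rw [Filter.eventually_all]
    intro i
    rw [Filter.eventually_all]
    intro j
    rcases (hvL.2 i j).eq_or_lt with hij | hij
    · refine Filter.Eventually.of_forall fun ε => ?_
      have hwij : w i = w j := by
        rcases eq_or_ne i j with rfl | hne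
        · rfl
        · have h1 := h _ (Submodule.subset_span
            ⟨elementaryVec_mem hne, (dotProduct_elementaryVec_eq_one_iff v hne).2 hij⟩)
          rw [dotProduct_elementaryVec, mul_eq_zero, inv_eq_zero] at h1
          exact sub_eq_zero.1 (h1.resolve_left (dist_pos.2 hne).ne')
      simp [hwij, hij]
    · have hc : Continuous fun ε : ℝ => (v + ε • w) i - (v + ε • w) j := by
        simp only [Pi.add_apply, Pi.smul_apply, smul_eq_mul]
        fun_prop
      have h0 : (v + (0 : ℝ) • w) i - (v + (0 : ℝ) • w) j < dist i j := by simpa using hij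
      exact (hc.continuousAt.eventually_lt continuousAt_const h0).mono fun _ h => h.le
  obtain ⟨δ, hδ, hball⟩ := Metric.eventually_nhds_iff.1 hev
  have hmem : ∀ ε : ℝ, |ε| < δ → v + ε • w ∈ lipschitzPolytope X := fun ε hε =>
    ⟨mem_sumZero.1 (Submodule.add_mem _ (mem_sumZero.2 hvL.1) (Submodule.smul_mem _ _ hw)),
      hball (by simpa using hε)⟩
  have h1 := hmem (δ / 2) (by rw [abs_of_pos (by linarith)]; linarith)
  have h2 := hmem (-(δ / 2)) (by rw [abs_neg, abs_of_pos (by linarith)]; linarith)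
  -- The backward move shows l w ≥ 0. The forward move is then also a maximiser, hence equal to v.
  have h3 := (hl _ h2).1
  simp only [map_add, map_smul, smul_eq_mul] at h3
  have h4 := (hl _ h1).2 (by simp only [map_add, map_smul, smul_eq_mul]; linarith)
  rw [add_eq_left, smul_eq_zero] at h4
  exact h4.resolve_left (by linarith)

/-- Two vertices with the same dual face both pair to 1 with a set that spans the sum-zero space. -/
theorem dualFace_injOn :
    Set.InjOn (dualFace (X := X)) ((lipschitzPolytope X).exposedPoints ℝ) := by
  intro v hv v' hv' h
  have h1 : sumZero X ≤ LinearMap.ker (dotProductBilin ℝ ℝ (v - v') : (X → ℝ) →ₗ[ℝ] ℝ) := by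
    rw [← span_dualFace hv, Submodule.span_le]
    intro e he
    have he' : e ∈ dualFace v' := h ▸ he
    change (v - v') ⬝ᵥ e = 0
    rw [sub_dotProduct, he.2, he'.2, sub_self]
  have h2 : v - v' ∈ sumZero X :=
    Submodule.sub_mem _ (mem_sumZero.2 hv.1.1) (mem_sumZero.2 hv'.1.1)
  refine sub_eq_zero.1 (eq_zero_of_forall_dotProduct_elementaryVec h2 fun i j _ => ?_)
  exact h1 (elementaryVec_mem_sumZero i j)

theorem isExposed_dualFace {v : X → ℝ} (hv : v ∈ lipschitzPolytope X) :
    IsExposed ℝ (fundamentalPolytope X) (dualFace v) := by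
  rintro ⟨f, hf⟩
  refine ⟨dotFunctional v, Set.ext fun e => ⟨fun he => ⟨he.1, fun y hy => ?_⟩, fun he =>
    ⟨he.1, le_antisymm (dotProduct_le_one hv he.1) ?_⟩⟩⟩
  · rw [dotFunctional_apply, dotFunctional_apply, he.2]
    exact dotProduct_le_one hv hy
  · have := he.2 f hf.1
    rwa [dotFunctional_apply, dotFunctional_apply, hf.2] at this

theorem convexDim_dualFace_add_two [Nontrivial X] {v : X → ℝ}
    (hv : v ∈ (lipschitzPolytope X).exposedPoints ℝ) :
    convexDim (dualFace v) + 2 = Fintype.card X := by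
  have hspan := span_dualFace hv
  have hcard := finrank_sumZero X
  have hne : (dualFace v).Nonempty := by
    by_contra hempty
    rw [Set.not_nonempty_iff_eq_empty.1 hempty, Submodule.span_empty] at hspan
    rw [← hspan, finrank_bot] at hcard
    have := Fintype.one_lt_card (α := X)
    omega
  have h1 := finrank_span_eq_finrank_vectorSpan_add_one hne (dotFunctional v).toLinearMap
    fun f hf => hf.2
  rw [hspan] at h1
  rw [convexDim, if_pos hne]
  omega

/-- Every facet of the fundamental polytope is dual to a vertex of the Lipschitz polytope. -/
theorem exists_eq_dualFace [Nontrivial X] {F : Set (X → ℝ)}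
    (hF : IsExposed ℝ (fundamentalPolytope X) F) (hdim : convexDim F + 2 = Fintype.card X) :
    ∃ v ∈ (lipschitzPolytope X).exposedPoints ℝ, dualFace v = F := by
  have hcard := finrank_sumZero X
  have hne : F.Nonempty := by
    by_contra hne
    rw [convexDim, if_neg hne] at hdim
    have := Fintype.one_lt_card (α := X)
    omega
  rw [convexDim, if_pos hne] at hdim
  obtain ⟨l, hl⟩ := hF hne
  obtain ⟨c, rfl⟩ := exists_eq_dotFunctional l
  obtain ⟨f₀, hf₀⟩ := hne
  have hf₀' := hf₀
  rw [hl] at hf₀'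
  obtain ⟨hf₀P, hmax⟩ := hf₀'
  simp only [dotFunctional_apply] at hmax hl
  set M := c ⬝ᵥ f₀ with hM
  have hmax' : ∀ i j : X, i ≠ j → c ⬝ᵥ elementaryVec i j ≤ M :=
    fun i j h => hmax _ (elementaryVec_mem h)
  have hFeq : F = {e | e ∈ fundamentalPolytope X ∧ c ⬝ᵥ e = M} := by
    rw [hl]
    ext e
    exact ⟨fun h => ⟨h.1, le_antisymm (hmax e h.1) (h.2 _ hf₀P)⟩,
      fun h => ⟨h.1, fun y hy => h.2 ▸ hmax y hy⟩⟩
  -- Generators come in opposite pairs, so M ≤ 0 would make c vanish on all of them. The face would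
  -- then be the whole polytope, which has too large a dimension.
  have hMpos : 0 < M := by
    by_contra hM0
    have hzero : ∀ i j : X, i ≠ j → c ⬝ᵥ elementaryVec i j = 0 := by
      intro i j hij
      have h1 := hmax' i j hij
      have h2 := hmax' j i hij.symm
      rw [elementaryVec_swap i j, dotProduct_neg] at h2
      linarith
    have hM0 : M = 0 := by
      obtain ⟨i, j, hij⟩ := exists_pair_ne X
      have h1 := hmax' i j hij
      rw [hzero i j hij] at h1
      linarith
    have hFP : F = fundamentalPolytope X := by
      rw [hFeq]
      ext e
      refine ⟨fun h => h.1, fun h => ⟨h, ?_⟩⟩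
      rw [hM0]
      refine le_antisymm (dotProduct_le_of_forall_elementaryVec (fun i j h => (hzero i j h).le) h)
        ?_
      have := dotProduct_le_of_forall_elementaryVec (x := -c) (c := 0)
        (fun i j hij => by rw [neg_dotProduct, hzero i j hij, neg_zero]) h
      rw [neg_dotProduct] at this
      linarith
    rw [hFP, vectorSpan_fundamentalPolytope] at hdim
    omega
  -- the normalised functional, projected to the sum-zero space
  let avg : ℝ := (∑ i, c i) / Fintype.card X
  let v : X → ℝ := M⁻¹ • (c - fun _ => avg)
  have hcard0 : (Fintype.card X : ℝ) ≠ 0 := by exact_mod_cast Fintype.card_ne_zero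
  have hv0 : v ∈ sumZero X := by
    refine Submodule.smul_mem _ _ (mem_sumZero.2 ?_)
    simp only [Pi.sub_apply, Finset.sum_sub_distrib, Finset.sum_const, Finset.card_univ,
      nsmul_eq_mul, avg]
    field_simp
    ring
  have hvdot : ∀ e ∈ fundamentalPolytope X, v ⬝ᵥ e = M⁻¹ * (c ⬝ᵥ e) := by
    intro e he
    have h1 : (fun _ : X => avg) ⬝ᵥ e = 0 := by
      have := mem_sumZero.1 (fundamentalPolytope_subset_sumZero he)
      simp only [dotProduct, ← Finset.mul_sum, this, mul_zero]
    rw [smul_dotProduct, sub_dotProduct, h1, sub_zero, smul_eq_mul]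
  have hvL : v ∈ lipschitzPolytope X := by
    refine mem_lipschitzPolytope_iff.2 ⟨hv0, fun e he => ?_⟩
    rw [hvdot e he, inv_mul_le_iff₀ hMpos, mul_one]
    exact hmax e he
  have hdual : dualFace v = F := by
    rw [hFeq]
    ext e
    refine and_congr_right fun he => ?_
    rw [hvdot e he, inv_mul_eq_iff_eq_mul₀ hMpos.ne', mul_one]
  refine ⟨v, ⟨hvL, ?_⟩, hdual⟩
  have hone : ∀ f ∈ F, v ⬝ᵥ f = 1 := fun f hf => by
    rw [← hdual] at hf
    exact hf.2
  have hFP : ∀ f ∈ F, f ∈ fundamentalPolytope X := fun f hf => by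
    rw [hFeq] at hf
    exact hf.1
  have hspan : Submodule.span ℝ F = sumZero X := by
    apply Submodule.eq_of_le_of_finrank_eq
    · rw [Submodule.span_le]
      exact fun f hf => fundamentalPolytope_subset_sumZero (hFP f hf)
    · rw [finrank_span_eq_finrank_vectorSpan_add_one ⟨f₀, hf₀⟩ (dotFunctional v).toLinearMap hone]
      omega
  obtain ⟨b, hbF, hbspan, hbind⟩ := exists_linearIndependent ℝ F
  have hbfin : b.Finite := hbind.setFinite
  have := hbfin.fintype
  -- Each f in the basis b taken from the facet is at most 1 on the Lipschitz polytope and equals 1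
  -- at v. A maximiser of their sum therefore agrees with v on a spanning set.
  refine ⟨dotFunctional (∑ f ∈ b.toFinset, f), fun y hy => ?_⟩
  have hle : ∀ f ∈ b.toFinset, f ⬝ᵥ y ≤ f ⬝ᵥ v := by
    intro f hf
    have hfF := hbF (Set.mem_toFinset.1 hf)
    rw [dotProduct_comm f v, hone f hfF, dotProduct_comm]
    exact dotProduct_le_one hy (hFP f hfF)
  simp only [dotFunctional_apply, sum_dotProduct]
  refine ⟨Finset.sum_le_sum hle, fun hge => ?_⟩
  have heq := (Finset.sum_eq_sum_iff_of_le hle).1 (le_antisymm (Finset.sum_le_sum hle) hge)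
  have hker : sumZero X ≤ LinearMap.ker (dotProductBilin ℝ ℝ (y - v) : (X → ℝ) →ₗ[ℝ] ℝ) := by
    rw [← hspan, ← hbspan, Submodule.span_le]
    intro f hf
    change (y - v) ⬝ᵥ f = 0
    rw [dotProduct_comm, dotProduct_sub, heq f (Set.mem_toFinset.2 hf), sub_self]
  refine sub_eq_zero.1 (eq_zero_of_forall_dotProduct_elementaryVec
    (Submodule.sub_mem _ (mem_sumZero.2 hy.1) hv0) fun i j _ => ?_)
  exact hker (elementaryVec_mem_sumZero i j)

variable (X) in
theorem numFacets_fundamentalPolytope [Nontrivial X] :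
    numFacets (fundamentalPolytope X) = numVertices (lipschitzPolytope X) := by
  rw [numVertices_eq_ncard_exposedPoints, ← dualFace_injOn.ncard_image]
  unfold numFacets faceNumber
  congr 1
  have hP := convexDim_fundamentalPolytope X
  ext F
  constructor
  · rintro ⟨hF, hdim⟩
    exact exists_eq_dualFace hF (by omega)
  · rintro ⟨v, hv, rfl⟩
    have := convexDim_dualFace_add_two hv
    exact ⟨isExposed_dualFace hv.1, by omega⟩

end Duality

/-! ### Uniqueness of split decompositions -/

namespace Split

variable {X : Type*}

theorem IsSide.compl {σ : Split X} {A : Set X} (h : σ.IsSide A) : σ.IsSide Aᶜ := by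
  obtain ⟨s, B, hB, hB', rfl⟩ := σ
  rcases Sym2.mem_iff.1 h with rfl | rfl
  · exact Sym2.mem_mk_right _ _
  · rw [compl_compl]
    exact Sym2.mem_mk_left _ _

theorem IsSide.nonempty {σ : Split X} {A : Set X} (h : σ.IsSide A) : A.Nonempty := by
  obtain ⟨s, B, hB, hB', rfl⟩ := σ
  rcases Sym2.mem_iff.1 h with rfl | rfl
  · exact hB
  · exact hB'

theorem IsSide.eq_or_eq_compl {σ : Split X} {A B : Set X} (hA : σ.IsSide A) (hB : σ.IsSide B) :
    B = A ∨ B = Aᶜ := by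
  obtain ⟨s, C, hC, hC', rfl⟩ := σ
  rcases Sym2.mem_iff.1 hA with rfl | rfl <;> rcases Sym2.mem_iff.1 hB with rfl | rfl <;> simp

theorem exists_isSide (σ : Split X) : ∃ A, σ.IsSide A := by
  obtain ⟨s, A, hA, hA', rfl⟩ := σ
  exact ⟨A, Sym2.mem_mk_left _ _⟩

theorem eq_of_isSide {σ τ : Split X} {A : Set X} (hσ : σ.IsSide A) (hτ : τ.IsSide A) : σ = τ := by
  obtain ⟨s, B, hB, hB', rfl⟩ := σ
  obtain ⟨t, C, hC, hC', rfl⟩ := τ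
  apply Subtype.ext
  change s(B, Bᶜ) = s(C, Cᶜ)
  have key : ∀ {D : Set X}, A ∈ s(D, Dᶜ) → s(D, Dᶜ) = s(A, Aᶜ) := by
    intro D hD
    rcases Sym2.mem_iff.1 hD with rfl | rfl
    · rfl
    · rw [compl_compl, Sym2.eq_swap]
  exact (key hσ).trans (key hτ).symm

open Classical in
theorem delta_eq {σ : Split X} {A : Set X} (hA : σ.IsSide A) (x y : X) :
    σ.delta x y = if (x ∈ A ↔ y ∈ A) then 0 else 1 := by
  unfold delta
  refine if_congr ⟨?_, fun h => ?_⟩ rfl rfl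
  · rintro ⟨B, hB, hx, hy⟩
    rcases hA.eq_or_eq_compl hB with rfl | rfl
    · exact iff_of_true hx hy
    · exact iff_of_false hx hy
  · by_cases hx : x ∈ A
    · exact ⟨A, hA, hx, h.1 hx⟩
    · exact ⟨Aᶜ, hA.compl, hx, fun hy => hx (h.2 hy)⟩

theorem delta_comm (σ : Split X) (x y : X) : σ.delta x y = σ.delta y x := by
  obtain ⟨A, hA⟩ := σ.exists_isSide
  classical
  simp only [delta_eq hA]
  exact if_congr iff_comm rfl rfl

/-- Since a and a' both avoid C, their term vanishes and the triangle inequality along b, a, a', b'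
remains. -/
theorem delta_four_point_of_disjoint {τ : Split X} {A C : Set X} (hC : τ.IsSide C)
    (h : A ∩ C = ∅) {a a' : X} (ha : a ∈ A) (ha' : a' ∈ A) (b b' : X) :
    τ.delta a a' + τ.delta b b' ≤ τ.delta a b + τ.delta a' b' := by
  have h1 : a ∉ C := fun hc => (h ▸ ⟨ha, hc⟩ : a ∈ (∅ : Set X))
  have h2 : a' ∉ C := fun hc => (h ▸ ⟨ha', hc⟩ : a' ∈ (∅ : Set X))
  simp only [delta_eq hC]
  split_ifs <;> norm_num <;> tauto

/-- With a and a' outside C, the left side counts how many of b, b' lie in C. This number is at most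
1, and then it equals `τ.delta b b'`. -/
theorem delta_four_point_ge {τ : Split X} {C : Set X} (hC : τ.IsSide C) {a a' b b' : X}
    (ha : a ∉ C) (ha' : a' ∉ C) (hb : ¬ (b ∈ C ∧ b' ∈ C)) :
    τ.delta a b + τ.delta a' b' ≤ τ.delta a a' + τ.delta b b' := by
  simp only [delta_eq hC]
  split_ifs <;> norm_num <;> tauto

theorem Compatible.delta_four_point {σ τ : Split X} (h : σ.Compatible τ) {A : Set X}
    (hA : σ.IsSide A) {a a' b b' : X} (ha : a ∈ A) (ha' : a' ∈ A) (hb : b ∉ A) (hb' : b' ∉ A) :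
    τ.delta a a' + τ.delta b b' ≤ τ.delta a b + τ.delta a' b' := by
  obtain ⟨B, C, hB, hC, hBC⟩ := h
  rcases hA.eq_or_eq_compl hB with rfl | rfl
  · exact delta_four_point_of_disjoint hC hBC ha ha' b b'
  · have := delta_four_point_of_disjoint hC hBC hb hb' a a'
    rw [τ.delta_comm a b, τ.delta_comm a' b']
    linarith

/-- If no split of `T` is `σ`, but all are compatible with each other and with `σ`, then each
side `A` of `σ` contains two points that are not both contained in the same smaller side. -/
theorem exists_pair_of_compatible [Finite X] {T : Set (Split X)}
    (hT : ∀ σ ∈ T, ∀ τ ∈ T, σ.Compatible τ) {A : Set X} (hA : A.Nonempty) (hA' : Aᶜ.Nonempty) :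
    ∃ a ∈ A, ∃ a' ∈ A, ∀ τ ∈ T, ∀ C, τ.IsSide C → C ⊂ A → ¬ (a ∈ C ∧ a' ∈ C) := by
  obtain ⟨x, hx⟩ := hA'
  by_cases hne : {C : Set X | C ⊂ A ∧ ∃ τ ∈ T, τ.IsSide C}.Nonempty
  · obtain ⟨C, ⟨hCA, τ, hτ, hC⟩, hmax⟩ := (Set.toFinite _).exists_maximal hne
    obtain ⟨a, ha⟩ := hC.nonempty
    obtain ⟨a', ha', hna'⟩ := Set.exists_of_ssubset hCA
    refine ⟨a, hCA.1 ha, a', ha', fun τ' hτ' D hD hDA hmem => ?_⟩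
    obtain ⟨C', D', hC', hD', hdisj⟩ := hT τ hτ τ' hτ'
    -- Of the four ways C and D can be compatible, a excludes disjointness, a' excludes D ⊆ C, and x
    -- excludes that they cover X. What is left is C ⊆ D, against the maximality of C.
    rcases hC.eq_or_eq_compl hC' with rfl | rfl <;> rcases hD.eq_or_eq_compl hD' with rfl | rfl
    · exact (hdisj ▸ ⟨ha, hmem.1⟩ : a ∈ (∅ : Set X))
    · have hCD : C' ⊆ D := fun z hz => by
        by_contra hzD
        exact (hdisj ▸ ⟨hz, hzD⟩ : z ∈ (∅ : Set X))
      exact hna' (hmax ⟨hDA, τ', hτ', hD⟩ hCD hmem.2)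
    · exact (hdisj ▸ ⟨hna', hmem.2⟩ : a' ∈ (∅ : Set X))
    · exact (hdisj ▸ ⟨fun h => hx (hCA.1 h), fun h => hx (hDA.1 h)⟩ : x ∈ (∅ : Set X))
  · obtain ⟨a, ha⟩ := hA
    exact ⟨a, ha, a, ha, fun τ hτ C hC hCA _ => hne ⟨C, hCA, τ, hτ, hC⟩⟩

end Split

open Split in
/-- The splits of a decomposition are determined by the four-point inequalities. -/
theorem IsSplitDecomposition.mem_iff {X : Type*} [Finite X] [PseudoMetricSpace X]
    {S : Finset (Split X)} (hS : IsSplitDecomposition X S) {σ : Split X} {A : Set X}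
    (hA : σ.IsSide A) :
    σ ∈ S ↔ ∀ a ∈ A, ∀ a' ∈ A, ∀ b ∉ A, ∀ b' ∉ A,
      dist a a' + dist b b' < dist a b + dist a' b' := by
  obtain ⟨hcomp, α, hα, hd⟩ := hS
  simp only [hd, ← Finset.sum_add_distrib, ← mul_add]
  constructor
  -- Every split of S satisfies the weak inequality. The split σ itself contributes 0 on the left
  -- and 2 on the right, which makes it strict.
  · intro hσ a ha a' ha' b hb b' hb'
    refine Finset.sum_lt_sum (fun τ hτ => mul_le_mul_of_nonneg_left
      ((hcomp σ hσ τ hτ).delta_four_point hA ha ha' hb hb') (hα τ hτ).le)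
      ⟨σ, hσ, mul_lt_mul_of_pos_left ?_ (hα σ hσ)⟩
    simp only [delta_eq hA]
    split_ifs <;> norm_num <;> tauto
  · intro hlt
    by_contra hσ
    by_cases hall : ∀ τ ∈ S, σ.Compatible τ
    -- Here σ is compatible with S but not in it. Pairs not jointly contained in any smaller side
    -- reverse the inequality for every split of S.
    · obtain ⟨a, ha, a', ha', h1⟩ :=
        exists_pair_of_compatible (T := S) hcomp hA.nonempty hA.compl.nonempty
      obtain ⟨b, hb, b', hb', h2⟩ := exists_pair_of_compatible (T := S) hcomp hA.compl.nonempty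
        (by rw [compl_compl]; exact hA.nonempty)
      refine (hlt a ha a' ha' b hb b' hb').not_ge (Finset.sum_le_sum fun τ hτ =>
        mul_le_mul_of_nonneg_left ?_ (hα τ hτ).le)
      obtain ⟨B, C, hB, hC, hBC⟩ := hall τ hτ
      have hsub : C ⊆ Bᶜ := fun z hz hzB => (hBC ▸ ⟨hzB, hz⟩ : z ∈ (∅ : Set X))
      have hss : C ⊂ Bᶜ := by
        refine lt_of_le_of_ne hsub fun h => hσ ?_
        rw [eq_of_isSide hB.compl (h ▸ hC)]
        exact hτ
      rcases hA.eq_or_eq_compl hB with rfl | rfl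
      · have hn := h2 τ hτ C hC hss
        exact delta_four_point_ge hC (fun h => hsub h ha) (fun h => hsub h ha') hn
      · rw [compl_compl] at hss hsub
        have hn := h1 τ hτ C hC hss
        have := delta_four_point_ge hC (fun h => hb (hsub h)) (fun h => hb' (hsub h)) hn
        rw [τ.delta_comm b a, τ.delta_comm b' a'] at this
        linarith
    · push Not at hall
      obtain ⟨τ, hτ, hinc⟩ := hall
      obtain ⟨C, hC⟩ := τ.exists_isSide
      -- Incompatibility supplies a point in each of the four intersections. The four-point
      -- inequality for the sides of τ is then the reverse of the one assumed for σ.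
      have hmeet : ∀ B D, σ.IsSide B → τ.IsSide D → (B ∩ D).Nonempty := fun B D hB hD =>
        Set.nonempty_iff_ne_empty.2 fun h => hinc ⟨B, D, hB, hD, h⟩
      obtain ⟨a, haA, haC⟩ := hmeet A C hA hC
      obtain ⟨a', haA', haC'⟩ := hmeet A Cᶜ hA hC.compl
      obtain ⟨b, hbA, hbC⟩ := hmeet Aᶜ C hA.compl hC
      obtain ⟨b', hbA', hbC'⟩ := hmeet Aᶜ Cᶜ hA.compl hC.compl
      refine (hlt a haA a' haA' b hbA b' hbA').not_ge (Finset.sum_le_sum fun ρ hρ =>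
        mul_le_mul_of_nonneg_left ?_ (hα ρ hρ).le)
      exact (hcomp τ hτ ρ hρ).delta_four_point hC haC hbC haC' hbC'

theorem IsSplitDecomposition.unique {X : Type*} [Finite X] [PseudoMetricSpace X]
    {S S' : Finset (Split X)} (hS : IsSplitDecomposition X S) (hS' : IsSplitDecomposition X S') :
    S' = S := by
  ext σ
  obtain ⟨A, hA⟩ := σ.exists_isSide
  rw [hS.mem_iff hA, hS'.mem_iff hA]

/-! ### Graphic matroids -/

/-- Hyperplanes and fan edges will both be indexed by the edges of the caterpillar, so independence
need only be compared on subsets of that index type. -/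
theorem matroidIso_of_index {ι α β : Type*} {M : Matroid α} {N : Matroid β} {u : ι → α}
    {v : ι → β} (hu : Function.Injective u) (hv : Function.Injective v) (huM : Set.range u = M.E)
    (hvN : Set.range v = N.E) (h : ∀ I : Set ι, M.Indep (u '' I) ↔ N.Indep (v '' I)) :
    MatroidIso M N := by
  let eu : ι ≃ M.E := (Equiv.ofInjective u hu).trans (Equiv.setCongr huM)
  let ev : ι ≃ N.E := (Equiv.ofInjective v hv).trans (Equiv.setCongr hvN)
  refine ⟨eu.symm.trans ev, fun I => ?_⟩
  have h1 : (Subtype.val '' I : Set α) = u '' (eu ⁻¹' I) := by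
    rw [← Set.image_preimage_eq I eu.surjective, Set.image_image,
      Set.preimage_image_eq _ eu.injective]
    rfl
  have h2 : (Subtype.val '' (eu.symm.trans ev '' I) : Set β) = v '' (eu ⁻¹' I) := by
    rw [← eu.image_symm_eq_preimage, Set.image_image, Set.image_image]
    rfl
  rw [h1, h2]
  exact h _

section Potential

variable {V M ι : Type*} [AddCommGroup M] [Module ℝ M] {s : V → M}

/-- The difference telescopes along a walk. -/
theorem sub_mem_span_of_reachable {a b : ι → V} {I : Set ι} {u v : V}
    (h : (SimpleGraph.fromEdgeSet ((fun i => s(a i, b i)) '' I)).Reachable u v) :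
    s v - s u ∈ Submodule.span ℝ ((fun i => s (b i) - s (a i)) '' I) := by
  obtain ⟨p⟩ := h
  induction p with
  | nil => simp
  | cons h p ih =>
    rename_i x y z
    obtain ⟨⟨i, hi, he⟩, -⟩ := (SimpleGraph.fromEdgeSet_adj _).1 h
    have hmem : s (b i) - s (a i) ∈ Submodule.span ℝ ((fun i => s (b i) - s (a i)) '' I) :=
      Submodule.subset_span ⟨i, hi, rfl⟩
    have h1 : s y - s x ∈ Submodule.span ℝ ((fun i => s (b i) - s (a i)) '' I) := by
      rcases Sym2.eq_iff.1 he with ⟨rfl, rfl⟩ | ⟨rfl, rfl⟩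
      · exact hmem
      · rw [← neg_sub]
        exact Submodule.neg_mem _ hmem
    have h2 := Submodule.add_mem _ ih h1
    rwa [sub_add_sub_cancel] at h2

-- Take as potential the indicator of the component of u. By `hs` a functional realises it; this
-- kills every edge difference in I, but not `s v - s u` if v lies in another component.
open Classical in
theorem reachable_of_sub_mem_span
    (hs : ∀ t : V → ℝ, ∃ ψ : Module.Dual ℝ M, ∀ u v, ψ (s u - s v) = t u - t v)
    {a b : ι → V} {I : Set ι} {u v : V}
    (h : s v - s u ∈ Submodule.span ℝ ((fun i => s (b i) - s (a i)) '' I)) :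
    (SimpleGraph.fromEdgeSet ((fun i => s(a i, b i)) '' I)).Reachable u v := by
  set G := SimpleGraph.fromEdgeSet ((fun i => s(a i, b i)) '' I) with hG
  by_contra hr
  obtain ⟨ψ, hψ⟩ := hs fun x => if G.Reachable u x then 1 else 0
  have hle : Submodule.span ℝ ((fun i => s (b i) - s (a i)) '' I) ≤ LinearMap.ker ψ := by
    rw [Submodule.span_le]
    rintro _ ⟨i, hi, rfl⟩
    change ψ (s (b i) - s (a i)) = 0
    rw [hψ]
    by_cases hab : a i = b i
    · rw [hab, sub_self]
    have hadj : G.Adj (a i) (b i) := (SimpleGraph.fromEdgeSet_adj _).2 ⟨⟨i, hi, rfl⟩, hab⟩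
    have hiff : G.Reachable u (a i) ↔ G.Reachable u (b i) :=
      ⟨fun h => h.trans hadj.reachable, fun h => h.trans hadj.symm.reachable⟩
    simp only [hiff, sub_self]
  have h0 : ψ (s v - s u) = 0 := hle h
  rw [hψ, if_neg hr, if_pos (SimpleGraph.Reachable.refl u)] at h0
  norm_num at h0

/-- Differences along edges are independent exactly if the edges contain no cycle. -/
theorem linearIndepOn_sub_iff_isAcyclic
    (hs : ∀ t : V → ℝ, ∃ ψ : Module.Dual ℝ M, ∀ u v, ψ (s u - s v) = t u - t v)
    {a b : ι → V} (hinj : Function.Injective fun i => s(a i, b i)) (hne : ∀ i, a i ≠ b i)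
    {I : Set ι} (hI : I.Finite) :
    LinearIndepOn ℝ (fun i => s (b i) - s (a i)) I ↔
      (SimpleGraph.fromEdgeSet ((fun i => s(a i, b i)) '' I)).IsAcyclic := by
  induction I, hI using Set.Finite.induction_on with
  | empty => simp
  | @insert e I he _ ih =>
    rw [linearIndepOn_insert he, ih, Set.image_insert_eq, fromEdgeSet_insert_eq,
      SimpleGraph.isAcyclic_sup_fromEdgeSet_iff]
    refine and_congr_right fun _ => ⟨fun h hr => (h (sub_mem_span_of_reachable hr)).elim,
      fun h hmem => ?_⟩
    -- The acyclicity criterion also admits coinciding end points and an edge already present; `hne`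
    -- and `hinj` exclude these.
    rcases h (reachable_of_sub_mem_span hs hmem) with h | h
    · exact hne e h
    · obtain ⟨⟨i, hi, hie⟩, -⟩ := (SimpleGraph.fromEdgeSet_adj _).1 h
      exact he (hinj hie ▸ hi)

end Potential

/-- Functionals with the same kernel are proportional, so the arbitrary choice in `normalCovector`
costs only a unit, which does not affect independence. -/
theorem normalCovector_ker {V : Type*} [AddCommGroup V] [Module ℝ V] {f : Module.Dual ℝ V}
    (hf : f ≠ 0) : ∃ c : ℝˣ, normalCovector (LinearMap.ker f) = c • f := by
  have h : ∃ g : Module.Dual ℝ V, g ≠ 0 ∧ LinearMap.ker g = LinearMap.ker f := ⟨f, hf, rfl⟩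
  rw [normalCovector, dif_pos h]
  obtain ⟨hg, hker⟩ := h.choose_spec
  set g := h.choose
  obtain ⟨x, hx⟩ : ∃ x, f x ≠ 0 := by
    by_contra! hx
    exact hf (LinearMap.ext hx)
  have hgx : g x ≠ 0 := fun h => hx (LinearMap.mem_ker.1 (hker ▸ LinearMap.mem_ker.2 h))
  refine ⟨Units.mk0 (g x / f x) (div_ne_zero hgx hx), LinearMap.ext fun y => ?_⟩
  have hy : y - (f y / f x) • x ∈ LinearMap.ker g := by
    rw [hker, LinearMap.mem_ker, map_sub, map_smul, smul_eq_mul, div_mul_cancel₀ _ hx, sub_self]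
  rw [LinearMap.mem_ker, map_sub, map_smul, smul_eq_mul, sub_eq_zero] at hy
  change g y = g x / f x * f y
  rw [hy]
  ring

/-- The matroid of an arrangement of kernels of pairwise independent functionals. -/
theorem indep_arrangementMatroid_iff {V ι : Type*} [AddCommGroup V] [Module ℝ V]
    {𝒜 : Finset (Submodule ℝ V)} {f : ι → Module.Dual ℝ V} (hf : ∀ i, f i ≠ 0)
    (h𝒜 : ∀ i, LinearMap.ker (f i) ∈ 𝒜) (hinj : Function.Injective fun i => LinearMap.ker (f i))
    (I : Set ι) :
    (arrangementMatroid 𝒜).Indep ((fun i => LinearMap.ker (f i)) '' I) ↔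
      LinearIndepOn ℝ f I := by
  choose c hc using fun i => normalCovector_ker (hf i)
  have h1 : (arrangementMatroid 𝒜).Indep ((fun i => LinearMap.ker (f i)) '' I) ↔
      (fun i => LinearMap.ker (f i)) '' I ⊆ (𝒜 : Set (Submodule ℝ V)) ∧
        LinearIndepOn ℝ normalCovector ((fun i => LinearMap.ker (f i)) '' I) := Iff.rfl
  have h2 : LinearIndepOn ℝ normalCovector ((fun i => LinearMap.ker (f i)) '' I) ↔
      LinearIndepOn ℝ (fun i => normalCovector (LinearMap.ker (f i))) I :=
    (linearIndependent_equiv' (Equiv.Set.imageOfInjOn _ I hinj.injOn) rfl).symm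
  rw [h1, h2]
  have h3 : (fun i => normalCovector (LinearMap.ker (f i))) = c • f := funext hc
  rw [h3]
  constructor
  · rintro ⟨-, h⟩
    exact (LinearIndependent.units_smul_iff (fun i : I => f i) (fun i : I => c i)).1 h
  · intro h
    refine ⟨?_, (LinearIndependent.units_smul_iff (fun i : I => f i) (fun i : I => c i)).2 h⟩
    rintro _ ⟨i, -, rfl⟩
    exact h𝒜 i

/-! ### Coordinates for caterpillar metrics -/

/-- Coordinates for a caterpillar metric on `m + 2` points: the path from the first to the last
leaf has edges of lengths `β 0, …, β m`, and the leaf number `k` is attached by a leg of length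
`h k` to its `k`-th vertex. -/
structure CaterpillarData (m : ℕ) (X : Type*) [PseudoMetricSpace X] where
  φ : X ≃ Fin (m + 2)
  β : ℕ → ℝ
  h : ℕ → ℝ
  β_pos : ∀ k, 0 < β k
  h_zero : h 0 = 0
  h_last : h (m + 1) = 0
  h_pos : ∀ k < m, 0 < h (k + 1)
  dist_eq : ∀ x y, x ≠ y → dist x y = h (φ x) + h (φ y) +
    |∑ k ∈ Finset.range (φ x), β k - ∑ k ∈ Finset.range (φ y), β k|

namespace Caterpillar

variable {m : ℕ}

/-- The vertices of the path from the first to the last leaf. -/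
def spine (m i : ℕ) : Fin (m + 2) ⊕ Fin (m + 2 - 2) :=
  if i = 0 then .inl 0 else if h : 1 ≤ i ∧ i ≤ m then .inr ⟨i - 1, by omega⟩
    else .inl (Fin.last (m + 1))

theorem spine_zero : spine m 0 = .inl 0 := rfl

theorem spine_succ (j : Fin (m + 2 - 2)) : spine m (j + 1) = .inr j := by
  have h := j.2
  rw [spine, if_neg (by omega), dif_pos (by omega)]
  rfl

theorem spine_last : spine m (m + 1) = .inl (Fin.last (m + 1)) := by
  rw [spine, if_neg (by omega), dif_neg (by omega)]

/-- The length of the edges of the path from the first to the last leaf. -/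
noncomputable def edgeLength (w : Sym2 (Fin (m + 2) ⊕ Fin (m + 2 - 2)) → ℝ) (k : ℕ) : ℝ :=
  -- The value 1 past the last edge is a dummy that keeps the length positive for every k.
  if k ≤ m then w s(spine m k, spine m (k + 1)) else 1

/-- The length of the leg at the leaf number `k`, which is `0` for the first and last leaf. -/
noncomputable def legLength (w : Sym2 (Fin (m + 2) ⊕ Fin (m + 2 - 2)) → ℝ) (k : ℕ) : ℝ :=
  if h : 1 ≤ k ∧ k ≤ m then w s(.inl ⟨k, by omega⟩, spine m k) else 0

/-- The index of the vertex of the path closest to a given vertex. -/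
def index : Fin (m + 2) ⊕ Fin (m + 2 - 2) → ℕ
  | .inl i => i
  | .inr j => j + 1

/-- The distance of a vertex to the path. -/
noncomputable def height (w : Sym2 (Fin (m + 2) ⊕ Fin (m + 2 - 2)) → ℝ) :
    Fin (m + 2) ⊕ Fin (m + 2 - 2) → ℝ
  | .inl i => legLength w i
  | .inr _ => 0

/-- The position of a vertex of the path. -/
noncomputable def position (w : Sym2 (Fin (m + 2) ⊕ Fin (m + 2 - 2)) → ℝ) (i : ℕ) : ℝ :=
  ∑ k ∈ Finset.range i, edgeLength w k

theorem adj_inl_inr (i : Fin (m + 2)) (j : Fin (m + 2 - 2)) :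
    (caterpillar (m + 2)).Adj (.inl i) (.inr j) ↔
      i.val = j.val + 1 ∨ (i.val = 0 ∧ j.val = 0) ∨ (i.val = m + 1 ∧ j.val + 1 = m) := by
  simp [caterpillar, SimpleGraph.fromRel_adj]

theorem adj_inr_inr (j k : Fin (m + 2 - 2)) :
    (caterpillar (m + 2)).Adj (.inr j) (.inr k) ↔ j.val + 1 = k.val ∨ k.val + 1 = j.val := by
  simp [caterpillar, SimpleGraph.fromRel_adj]
  omega

theorem not_adj_inl_inl (i j : Fin (m + 2)) :
    ¬ (caterpillar (m + 2)).Adj (.inl i) (.inl j) := by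
  simp [caterpillar, SimpleGraph.fromRel_adj]

variable {w : Sym2 (Fin (m + 2) ⊕ Fin (m + 2 - 2)) → ℝ}

theorem adj_spine (hm : 1 ≤ m) {k : ℕ} (hk : k ≤ m) :
    (caterpillar (m + 2)).Adj (spine m k) (spine m (k + 1)) := by
  rcases Nat.eq_zero_or_pos k with rfl | hk0
  · have h1 := spine_succ (m := m) ⟨0, by omega⟩
    simp only [zero_add] at h1 ⊢
    rw [spine_zero, h1, adj_inl_inr]
    simp
  obtain ⟨j, rfl⟩ : ∃ j, k = j + 1 := ⟨k - 1, by omega⟩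
  have h1 := spine_succ (m := m) ⟨j, by omega⟩
  simp only at h1
  rcases hk.eq_or_lt with rfl | hk
  · rw [h1, spine_last, SimpleGraph.adj_comm, adj_inl_inr]
    simp
  · have h2 := spine_succ (m := m) ⟨j + 1, by omega⟩
    simp only at h2
    rw [h1, h2, adj_inr_inr]
    simp

theorem edgeLength_pos (hm : 1 ≤ m) (hw : ∀ e ∈ (caterpillar (m + 2)).edgeSet, 0 < w e) (k : ℕ) :
    0 < edgeLength w k := by
  unfold edgeLength
  split_ifs with hk
  · exact hw _ (adj_spine hm hk)
  · exact one_pos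

theorem adj_leg {k : ℕ} (hk : k < m) :
    (caterpillar (m + 2)).Adj (.inl ⟨k + 1, by omega⟩) (spine m (k + 1)) := by
  have h1 := spine_succ (m := m) ⟨k, by omega⟩
  simp only at h1
  rw [h1, adj_inl_inr]
  simp

theorem legLength_pos (hw : ∀ e ∈ (caterpillar (m + 2)).edgeSet, 0 < w e) {k : ℕ} (hk : k < m) :
    0 < legLength w (k + 1) := by
  unfold legLength
  rw [dif_pos (by omega)]
  exact hw _ (adj_leg hk)

theorem legLength_zero : legLength w 0 = 0 := dif_neg (by omega)

theorem legLength_last : legLength w (m + 1) = 0 := dif_neg (by omega)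

theorem legLength_nonneg (hw : ∀ e ∈ (caterpillar (m + 2)).edgeSet, 0 < w e) (k : ℕ) :
    0 ≤ legLength w k := by
  by_cases hk : 1 ≤ k ∧ k ≤ m
  · obtain ⟨j, rfl⟩ : ∃ j, k = j + 1 := ⟨k - 1, by omega⟩
    exact (legLength_pos hw (by omega)).le
  · rw [legLength, dif_neg hk]

theorem height_nonneg (hw : ∀ e ∈ (caterpillar (m + 2)).edgeSet, 0 < w e) (a) :
    0 ≤ height w a := by
  rcases a with i | j
  · exact legLength_nonneg hw i
  · exact le_refl (0 : ℝ)

theorem abs_position_sub_succ (hm : 1 ≤ m)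
    (hw : ∀ e ∈ (caterpillar (m + 2)).edgeSet, 0 < w e) {k : ℕ} (hk : k ≤ m) :
    |position w k - position w (k + 1)| = w s(spine m k, spine m (k + 1)) := by
  have h1 := edgeLength_pos hm hw k
  rw [position, position, Finset.sum_range_succ, sub_add_cancel_left, abs_neg, abs_of_pos h1,
    edgeLength, if_pos hk]

theorem weight_inl_inr (hm : 1 ≤ m) (hw : ∀ e ∈ (caterpillar (m + 2)).edgeSet, 0 < w e)
    {i : Fin (m + 2)} {j : Fin (m + 2 - 2)} (h : (caterpillar (m + 2)).Adj (.inl i) (.inr j)) :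
    w s(.inl i, .inr j) = legLength w i + |position w i - position w (j + 1)| := by
  have hj := j.2
  rcases (adj_inl_inr i j).1 h with h | ⟨hi, hj⟩ | ⟨hi, hj⟩
  · have hs := spine_succ j
    rw [← h] at hs ⊢
    rw [sub_self, abs_zero, add_zero, legLength, dif_pos (by omega), hs]
  · have hs := spine_succ j
    rw [hi, hj, legLength_zero, abs_position_sub_succ hm hw (by omega), zero_add, spine_zero]
    rw [hj] at hs
    rw [hs]
    have : i = 0 := Fin.ext hi
    rw [this]
  · have hs := spine_succ j
    rw [hj] at hs
    rw [hi, hj, legLength_last, abs_sub_comm, abs_position_sub_succ hm hw le_rfl, zero_add,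
      spine_last, hs, Sym2.eq_swap]
    have : i = Fin.last (m + 1) := Fin.ext hi
    rw [this]

theorem weight_eq (hm : 1 ≤ m) (hw : ∀ e ∈ (caterpillar (m + 2)).edgeSet, 0 < w e)
    {a b} (h : (caterpillar (m + 2)).Adj a b) :
    w s(a, b) = height w a + height w b + |position w (index a) - position w (index b)| := by
  rcases a with i | i <;> rcases b with j | j
  · exact (not_adj_inl_inl i j h).elim
  · rw [weight_inl_inr hm hw h, height, height, index, index, add_zero]
  · rw [Sym2.eq_swap, weight_inl_inr hm hw h.symm, height, height, index, index, zero_add,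
      abs_sub_comm]
  · have hi := i.2
    have hj := j.2
    rw [height, height, index, index, add_zero, zero_add]
    rcases (adj_inr_inr i j).1 h with h | h
    · rw [← h, abs_position_sub_succ hm hw (by omega), spine_succ, h, spine_succ]
    · rw [← h, abs_sub_comm, abs_position_sub_succ hm hw (by omega), spine_succ, h, spine_succ,
        Sym2.eq_swap]

/-- By `weight_eq` every edge attains the claimed distance formula. In the induction the height of
the intermediate vertex is nonnegative and the positions obey the triangle inequality. At a = b the
formula would count the height twice, so closed walks get only nonnegativity. -/
theorem le_sum_edges (hm : 1 ≤ m) (hw : ∀ e ∈ (caterpillar (m + 2)).edgeSet, 0 < w e) {a b}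
    (p : (caterpillar (m + 2)).Walk a b) :
    0 ≤ (p.edges.map w).sum ∧ (a ≠ b →
      height w a + height w b + |position w (index a) - position w (index b)| ≤
        (p.edges.map w).sum) := by
  induction p with
  | nil => simp
  | cons h p ih =>
    rename_i a c b
    obtain ⟨ih0, ih1⟩ := ih
    rw [SimpleGraph.Walk.edges_cons, List.map_cons, List.sum_cons]
    have hpos := hw s(a, c) h
    refine ⟨by linarith, fun _ => ?_⟩
    rw [weight_eq hm hw h]
    by_cases hcb : c = b
    · subst hcb
      linarith
    · have h1 := ih1 hcb
      have h2 := height_nonneg hw c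
      have h3 := abs_sub_le (position w (index a)) (position w (index c)) (position w (index b))
      linarith

theorem exists_walk_spine (hm : 1 ≤ m) {i j : ℕ} (hij : i ≤ j) (hj : j ≤ m + 1) :
    ∃ p : (caterpillar (m + 2)).Walk (spine m i) (spine m j),
      (p.edges.map w).sum = position w j - position w i := by
  induction j, hij using Nat.le_induction with
  | base => exact ⟨.nil, by simp⟩
  | succ j hij ih =>
    obtain ⟨p, hp⟩ := ih (by omega)
    refine ⟨p.concat (adj_spine hm (by omega)), ?_⟩
    rw [SimpleGraph.Walk.edges_concat, List.map_concat, List.sum_concat, hp, position, position,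
      position, Finset.sum_range_succ, edgeLength, if_pos (by omega)]
    ring

theorem exists_walk_leg (i : Fin (m + 2)) :
    ∃ p : (caterpillar (m + 2)).Walk (.inl i) (spine m i),
      (p.edges.map w).sum = legLength w i := by
  by_cases hi : 1 ≤ i.val ∧ i.val ≤ m
  · obtain ⟨k, hk', hk⟩ : ∃ k, ∃ h : k + 1 < m + 2, i = ⟨k + 1, h⟩ :=
      ⟨i - 1, by omega, Fin.ext (by simp; omega)⟩
    subst hk
    refine ⟨(adj_leg (Nat.lt_of_succ_le hi.2)).toWalk, ?_⟩
    rw [legLength, dif_pos hi]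
    simp
  · have hs : spine m i = .inl i := by
      rcases Nat.eq_zero_or_pos i.val with h0 | h0
      · have : i = 0 := Fin.ext h0
        rw [this]
        rfl
      · have : i = Fin.last (m + 1) := Fin.ext (by simp; omega)
        rw [this]
        exact spine_last
    rw [hs]
    exact ⟨.nil, by simp [legLength, dif_neg hi]⟩

theorem exists_walk (hm : 1 ≤ m) (hw : ∀ e ∈ (caterpillar (m + 2)).edgeSet, 0 < w e)
    (i j : Fin (m + 2)) :
    ∃ p : (caterpillar (m + 2)).Walk (.inl i) (.inl j), (p.edges.map w).sum =
      legLength w i + legLength w j + |position w i - position w j| := by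
  wlog hij : i ≤ j
  · obtain ⟨p, hp⟩ := this hm hw j i (le_of_not_ge hij)
    refine ⟨p.reverse, ?_⟩
    rw [SimpleGraph.Walk.edges_reverse, List.map_reverse, List.sum_reverse, hp, abs_sub_comm]
    ring
  obtain ⟨p, hp⟩ := exists_walk_leg (w := w) i
  obtain ⟨q, hq⟩ := exists_walk_leg (w := w) j
  obtain ⟨r, hr⟩ := exists_walk_spine (w := w) hm (Fin.le_def.1 hij) (by omega)
  refine ⟨(p.append r).append q.reverse, ?_⟩
  have hmono : position w i ≤ position w j :=
    Finset.sum_le_sum_of_subset_of_nonneg (Finset.range_mono (Fin.le_def.1 hij))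
      fun k _ _ => (edgeLength_pos hm hw k).le
  rw [SimpleGraph.Walk.edges_append, SimpleGraph.Walk.edges_append,
    SimpleGraph.Walk.edges_reverse, List.map_append, List.map_append, List.map_reverse,
    List.sum_append, List.sum_append, List.sum_reverse, hp, hq, hr, abs_sub_comm,
    abs_of_nonneg (sub_nonneg.2 hmono)]
  ring

theorem weightedDist_eq (hm : 1 ≤ m) (hw : ∀ e ∈ (caterpillar (m + 2)).edgeSet, 0 < w e)
    {i j : Fin (m + 2)} (hij : i ≠ j) :
    weightedDist (caterpillar (m + 2)) w (.inl i) (.inl j) =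
      legLength w i + legLength w j + |position w i - position w j| := by
  obtain ⟨p, hp⟩ := exists_walk hm hw i j
  have hlb : ∀ r ∈ Set.range fun p : (caterpillar (m + 2)).Walk (.inl i) (.inl j) =>
      (p.edges.map w).sum, legLength w i + legLength w j + |position w i - position w j| ≤ r := by
    rintro _ ⟨q, rfl⟩
    exact (le_sum_edges hm hw q).2 fun h => hij (Sum.inl_injective h)
  exact le_antisymm (hp ▸ csInf_le ⟨_, hlb⟩ ⟨p, rfl⟩) (le_csInf ⟨_, p, rfl⟩ hlb)

end Caterpillar

open Caterpillar in
theorem IsCaterpillarMetric.nonempty_data {m : ℕ} (hm : 1 ≤ m) {X : Type*} [PseudoMetricSpace X]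
    (hX : IsCaterpillarMetric (m + 2) X) : Nonempty (CaterpillarData m X) := by
  obtain ⟨φ, w, hw, hd⟩ := hX
  exact ⟨{
    φ := φ
    β := edgeLength w
    h := legLength w
    β_pos := edgeLength_pos hm hw
    h_zero := legLength_zero
    h_last := legLength_last
    h_pos := fun k hk => legLength_pos hw hk
    dist_eq := fun x y hxy => by
      rw [hd, weightedDist_eq hm hw (φ.injective.ne hxy)]
      rfl }⟩

/-! ### Vertices of zonotopes -/

/-- The sign encoded by a Boolean. -/
def boolSign (b : Bool) : ℝ := if b then 1 else -1

theorem boolSign_injective : Function.Injective boolSign := by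
  intro a b h
  cases a <;> cases b <;> simp [boolSign] at h ⊢ <;> norm_num at h

theorem abs_boolSign (b : Bool) : |boolSign b| = 1 := by
  cases b <;> simp [boolSign]

theorem mul_le_boolSign_mul {b : Bool} {a t : ℝ} (ha : 0 < boolSign b * a) (ht : |t| ≤ 1) :
    t * a ≤ boolSign b * a := by
  obtain ⟨h1, h2⟩ := abs_le.1 ht
  cases b <;> simp only [boolSign, if_true, Bool.false_eq_true, if_false] at ha ⊢ <;> nlinarith

theorem eq_boolSign_of_mul_eq {b : Bool} {a t : ℝ} (ha : 0 < boolSign b * a)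
    (h : t * a = boolSign b * a) : t = boolSign b :=
  mul_right_cancel₀ (right_ne_zero_of_mul ha.ne') h

section Zonotope

variable {E ι : Type*} [AddCommGroup E] [Module ℝ E] [TopologicalSpace E] [Fintype ι]

/-- The Minkowski sum of the segments `[-g e, g e]`. -/
def zonotope (g : ι → E) : Set E :=
  {x | ∃ t : ι → ℝ, (∀ e, |t e| ≤ 1) ∧ x = ∑ e, t e • g e}

/-- The sign vectors of the regions of the dual arrangement of a zonotope. -/
def regionSigns (g : ι → E) : Set (ι → Bool) :=
  {ε | ∃ l : E →L[ℝ] ℝ, ∀ e, 0 < boolSign (ε e) * l (g e)}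

omit [TopologicalSpace E] in
theorem signedSum_mem_zonotope (g : ι → E) (ε : ι → Bool) :
    ∑ e, boolSign (ε e) • g e ∈ zonotope g :=
  ⟨_, fun e => (abs_boolSign (ε e)).le, rfl⟩

/-- The maximum of l over the zonotope is attained term by term. As l vanishes on no generator,
every coefficient of a maximiser is forced. -/
theorem eq_boolSign_of_le {g : ι → E} {l : E →L[ℝ] ℝ} {ε : ι → Bool}
    (hl : ∀ e, 0 < boolSign (ε e) * l (g e)) {t : ι → ℝ} (ht : ∀ e, |t e| ≤ 1)
    (hle : l (∑ e, boolSign (ε e) • g e) ≤ l (∑ e, t e • g e)) (e : ι) :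
    t e = boolSign (ε e) := by
  simp only [map_sum, map_smul, smul_eq_mul] at hle
  have hterm : ∀ e ∈ Finset.univ, t e * l (g e) ≤ boolSign (ε e) * l (g e) :=
    fun e _ => mul_le_boolSign_mul (hl e) (ht e)
  exact eq_boolSign_of_mul_eq (hl e) ((Finset.sum_eq_sum_iff_of_le hterm).1
    (le_antisymm (Finset.sum_le_sum hterm) hle) e (Finset.mem_univ e))

/-- A functional has a unique maximiser exactly if it vanishes on no generator, and its signs on the
generators are then the coefficients of that maximiser. -/
theorem exposedPoints_zonotope {g : ι → E} (hg : ∀ e, g e ≠ 0) :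
    (zonotope g).exposedPoints ℝ = (fun ε => ∑ e, boolSign (ε e) • g e) '' regionSigns g := by
  classical
  ext x
  constructor
  · rintro ⟨⟨t, ht, rfl⟩, l, hl⟩
    have hne : ∀ e, l (g e) ≠ 0 := by
      intro e he
      -- If l vanished on `g e`, replacing the coefficient `t e` by any other admissible c would
      -- give a second maximiser.
      obtain ⟨c, hc, hct⟩ : ∃ c : ℝ, |c| ≤ 1 ∧ c ≠ t e := by
        by_cases h : t e = 1
        · exact ⟨0, by simp, by rw [h]; norm_num⟩
        · exact ⟨1, by simp, Ne.symm h⟩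
      have hsum : ∑ i, Function.update t e c i • g i = ∑ i, t i • g i + (c - t e) • g e := by
        rw [← Finset.add_sum_erase _ _ (Finset.mem_univ e),
          ← Finset.add_sum_erase _ (fun i => t i • g i) (Finset.mem_univ e),
          Function.update_self, Finset.sum_congr rfl fun i hi => by
            rw [Function.update_of_ne (Finset.ne_of_mem_erase hi)], sub_smul]
        abel
      have h1 := (hl (∑ i, Function.update t e c i • g i) ⟨_, fun i => by
        by_cases hi : i = e
        · subst hi
          rwa [Function.update_self]
        · rw [Function.update_of_ne hi]
          exact ht i, rfl⟩).2
      rw [hsum, map_add, map_smul, he, smul_zero, add_zero] at h1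
      have h2 := h1 le_rfl
      rw [add_eq_left, smul_eq_zero] at h2
      exact h2.elim (fun h => hct (sub_eq_zero.1 h)) (hg e)
    have hpos : ∀ e, 0 < boolSign (decide (0 < l (g e))) * l (g e) := by
      intro e
      by_cases h : 0 < l (g e)
      · simp [h, boolSign]
      · simp only [h, decide_false, boolSign, Bool.false_eq_true, if_false]
        have := lt_of_le_of_ne (not_lt.1 h) (hne e)
        linarith
    refine ⟨fun e => decide (0 < l (g e)), ⟨l, hpos⟩, ?_⟩
    refine (hl _ (signedSum_mem_zonotope g _)).2 ?_
    simp only [map_sum, map_smul, smul_eq_mul]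
    exact Finset.sum_le_sum fun e _ => mul_le_boolSign_mul (hpos e) (ht e)
  · rintro ⟨ε, ⟨l, hl⟩, rfl⟩
    refine ⟨signedSum_mem_zonotope g ε, l, ?_⟩
    rintro _ ⟨t, ht, rfl⟩
    refine ⟨?_, fun hle => Finset.sum_congr rfl fun e _ => by rw [eq_boolSign_of_le hl ht hle e]⟩
    simp only [map_sum, map_smul, smul_eq_mul]
    exact Finset.sum_le_sum fun e _ => mul_le_boolSign_mul (hl e) (ht e)

theorem ncard_exposedPoints_zonotope {g : ι → E} (hg : ∀ e, g e ≠ 0) :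
    ((zonotope g).exposedPoints ℝ).ncard = (regionSigns g).ncard := by
  rw [exposedPoints_zonotope hg, Set.InjOn.ncard_image]
  rintro ε ⟨l, hl⟩ ε' - h
  ext1 e
  exact boolSign_injective
    (eq_boolSign_of_le hl (fun e => (abs_boolSign (ε' e)).le) (congrArg l h).le e).symm

end Zonotope

/-! ### Acyclic orientations of the fan -/

/-- Words in `Bool` and their steps that satisfy the acyclicity condition at every triangle. -/
abbrev FanOrientation (m : ℕ) : Type :=
  {p : (Fin (m + 1) → Bool) × (Fin m → Bool) //
    ∀ k, p.1 k.castSucc = p.2 k → p.1 k.succ = p.1 k.castSucc}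

/-- Peels off the first spoke and the first rim edge. They interact with the rest only through the
next spoke. -/
def fanOrientationSuccEquiv (m : ℕ) : FanOrientation (m + 1) ≃
    Σ p : FanOrientation m, {q : Bool × Bool // q.1 = q.2 → p.1.1 0 = q.1} where
  toFun p := ⟨⟨(Fin.tail p.1.1, Fin.tail p.1.2), fun k => p.2 k.succ⟩,
    ⟨(p.1.1 0, p.1.2 0), p.2 0⟩⟩
  invFun p := ⟨(Fin.cons p.2.1.1 p.1.1.1, Fin.cons p.2.1.2 p.1.1.2),
    Fin.cases p.2.2 fun k => p.1.2 k⟩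
  left_inv _ := Subtype.ext (Prod.ext (Fin.cons_self_tail _) (Fin.cons_self_tail _))
  right_inv _ := rfl

theorem card_fanOrientation (m : ℕ) : Fintype.card (FanOrientation m) = 2 * 3 ^ m := by
  induction m with
  | zero => rfl
  | succ m ih =>
    rw [Fintype.card_congr (fanOrientationSuccEquiv m), Fintype.card_sigma]
    -- For a given next spoke, the two pairs with q.1 ≠ q.2 are free, and of the two equal pairs one
    -- is allowed.
    have h : ∀ b : Bool, Fintype.card {q : Bool × Bool // q.1 = q.2 → b = q.1} = 3 := by decide
    simp only [h, Finset.sum_const, Finset.card_univ, ih, smul_eq_mul]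
    ring

theorem ncard_setOf_fanOrientation (m : ℕ) :
    {ε : Fin (m + 1) ⊕ Fin m → Bool | ∀ k : Fin m, ε (.inl k.castSucc) = ε (.inr k) →
      ε (.inl k.succ) = ε (.inl k.castSucc)}.ncard = 2 * 3 ^ m := by
  rw [← card_fanOrientation, ← Nat.card_eq_fintype_card, ← Nat.card_coe_set_eq]
  exact Nat.card_congr ((Equiv.sumArrowEquivProdArrow _ _ _).subtypeEquiv fun ε => Iff.rfl)

/-- Every sign pattern satisfying the triangle conditions is realised by a potential. -/
theorem exists_potential_of_fanOrientation {m : ℕ} {ε : Fin (m + 1) ⊕ Fin m → Bool}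
    (hε : ∀ k : Fin m, ε (.inl k.castSucc) = ε (.inr k) →
      ε (.inl k.succ) = ε (.inl k.castSucc)) :
    ∃ t : ℕ → ℝ, (∀ k : Fin (m + 1), 0 < boolSign (ε (.inl k)) * t (k + 1)) ∧
      ∀ k : Fin m, 0 < boolSign (ε (.inr k)) * (t (k + 2) - t (k + 1)) := by
  -- Given a of sign x, a number b of sign z with b - a of sign y exists unless moving away from 0
  -- is required to change the sign.
  have step : ∀ (x y z : Bool) (a : ℝ), (x = y → z = x) → 0 < boolSign x * a →
      ∃ b, 0 < boolSign z * b ∧ 0 < boolSign y * (b - a) := by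
    intro x y z a h ha
    cases x <;> cases y <;> cases z <;> simp [boolSign] at h ha ⊢
    · exact ⟨a - 1, by linarith, by linarith⟩
    · exact ⟨a / 2, by linarith, by linarith⟩
    · exact ⟨1, by linarith, by linarith⟩
    · exact ⟨-1, by linarith, by linarith⟩
    · exact ⟨a / 2, by linarith, by linarith⟩
    · exact ⟨a + 1, by linarith, by linarith⟩
  choose! next hnext using step
  let s : ℕ → ℝ := fun k => Nat.rec (boolSign (ε (.inl 0)))
    (fun k a => if h : k < m then
      next (ε (.inl (Fin.castSucc ⟨k, h⟩))) (ε (.inr ⟨k, h⟩)) (ε (.inl (Fin.succ ⟨k, h⟩))) a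
      else 0) k
  have hs : ∀ k : Fin m, s (k + 1) =
      next (ε (.inl k.castSucc)) (ε (.inr k)) (ε (.inl k.succ)) (s k) := fun k => dif_pos k.2
  have hpos : ∀ k : Fin (m + 1), 0 < boolSign (ε (.inl k)) * s k := by
    intro k
    induction k using Fin.induction with
    | zero =>
      change 0 < boolSign (ε (.inl 0)) * boolSign (ε (.inl 0))
      cases ε (.inl 0) <;> simp [boolSign]
    | succ k ih =>
      rw [Fin.val_succ, hs]
      exact (hnext _ _ _ _ (hε k) ih).1
  -- The number s k belongs to the path vertex k + 1 of the fan. The value at the hub 0 is not used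
  -- here.
  refine ⟨fun k => s (k - 1), hpos, fun k => ?_⟩
  change 0 < _ * (s (k + 1) - s k)
  rw [hs]
  exact (hnext _ _ _ _ (hε k) (hpos k.castSucc)).2

/-! ### The vectors of the sides of a split -/

section SideVec

variable {X : Type*} [Fintype X]

/-- The split vector is the indicator minus its mean. Hence its coordinate differences, and its
pairings with sum-zero vectors, are those of the indicator. -/
theorem sideVec_apply [Nonempty X] (A : Set X) (x : X) :
    Split.sideVec A x = A.indicator 1 x - (A.ncard : ℝ) / Nat.card X := by
  have hc : (A.ncard : ℝ) + (Aᶜ.ncard : ℝ) = Nat.card X := by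
    exact_mod_cast Set.ncard_add_ncard_compl A
  have hn : (Nat.card X : ℝ) ≠ 0 := by
    exact_mod_cast Nat.card_pos.ne'
  by_cases hx : x ∈ A
  · have hx' : x ∉ Aᶜ := fun h => h hx
    simp only [Split.sideVec, Pi.sub_apply, Pi.smul_apply, Set.indicator_of_mem hx,
      Set.indicator_of_notMem hx', Pi.one_apply, smul_eq_mul]
    field_simp
    linarith
  · have hx' : x ∈ Aᶜ := hx
    simp only [Split.sideVec, Pi.sub_apply, Pi.smul_apply, Set.indicator_of_mem hx',
      Set.indicator_of_notMem hx, Pi.one_apply, smul_eq_mul]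
    ring

theorem sum_sideVec [Nonempty X] (A : Set X) : ∑ x, Split.sideVec A x = 0 := by
  classical
  have hn : (Nat.card X : ℝ) ≠ 0 := by
    exact_mod_cast Nat.card_pos.ne'
  have h1 : ∑ x, A.indicator (1 : X → ℝ) x = A.ncard := by
    simp only [Set.indicator_apply, Pi.one_apply, Finset.sum_boole]
    rw [Set.ncard_eq_toFinset_card']
    congr 2
    ext
    simp
  simp only [sideVec_apply, Finset.sum_sub_distrib, h1, Finset.sum_const, Finset.card_univ,
    nsmul_eq_mul, ← Nat.card_eq_fintype_card]
  field_simp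
  ring

theorem sideVec_sub [Nonempty X] (A : Set X) (x y : X) :
    Split.sideVec A x - Split.sideVec A y = A.indicator 1 x - A.indicator 1 y := by
  rw [sideVec_apply, sideVec_apply]
  ring

theorem eq_of_sub_eq_sub [Nonempty X] {x y : X → ℝ} (hx : ∑ i, x i = 0) (hy : ∑ i, y i = 0)
    (h : ∀ i j, x i - x j = y i - y j) : x = y := by
  ext i
  have h1 : ∑ j, (x i - x j) = ∑ j, (y i - y j) := Finset.sum_congr rfl fun j _ => h i j
  rw [Finset.sum_sub_distrib, Finset.sum_sub_distrib, hx, hy, sub_zero, sub_zero,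
    Finset.sum_const, Finset.sum_const] at h1
  exact smul_right_injective ℝ (Finset.card_ne_zero.2 Finset.univ_nonempty) h1

theorem dotProduct_sideVec_of_sum_eq_zero [Nonempty X] {c : X → ℝ} (hc : ∑ i, c i = 0)
    (A : Set X) : c ⬝ᵥ Split.sideVec A = c ⬝ᵥ A.indicator 1 := by
  have h : Split.sideVec A = A.indicator 1 - fun _ => (A.ncard : ℝ) / Nat.card X :=
    funext (sideVec_apply A)
  have h2 : c ⬝ᵥ (fun _ : X => (A.ncard : ℝ) / Nat.card X) = 0 := by
    simp only [dotProduct, ← Finset.sum_mul, hc, zero_mul]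
  rw [h, dotProduct_sub, h2, sub_zero]

end SideVec

theorem sum_range_sub_mul_cut (a : ℕ → ℝ) {i N : ℕ} (h : i ≤ N) :
    ∑ k ∈ Finset.range N, (a k - a (k + 1)) * (if i < k + 1 then 1 else 0) = a i - a N := by
  induction N, h using Nat.le_induction with
  | base =>
    rw [sub_self]
    refine Finset.sum_eq_zero fun k hk => ?_
    rw [if_neg (by simpa using Finset.mem_range.1 hk), mul_zero]
  | succ N hN ih =>
    rw [Finset.sum_range_succ, ih, if_pos (by omega)]
    ring

/-- Vanishing at 0 and m + 1 accounts for the two end leaves, which have no leg. -/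
theorem sum_range_mul_ite_eq {m : ℕ} {b : ℕ → ℝ} (h0 : b 0 = 0) (hm : b (m + 1) = 0) {i : ℕ}
    (hi : i ≤ m + 1) :
    ∑ k ∈ Finset.range m, b (k + 1) * (if i = k + 1 then 1 else 0) = b i := by
  simp only [mul_ite, mul_one, mul_zero]
  rcases Nat.eq_zero_or_pos i with rfl | hpos
  · rw [h0]
    exact Finset.sum_eq_zero fun k _ => if_neg (by omega)
  obtain ⟨j, rfl⟩ : ∃ j, i = j + 1 := ⟨i - 1, by omega⟩
  simp only [Nat.add_right_cancel_iff, Finset.sum_ite_eq, Finset.mem_range]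
  split_ifs with hj
  · rfl
  · have : j = m := by omega
    rw [this, hm]

/-! ### The Lipschitz polytope of a caterpillar as a zonotope -/

namespace CaterpillarData

variable {m : ℕ} {X : Type*}

section

variable [PseudoMetricSpace X] (D : CaterpillarData m X)

/-- The points in front of position `k`. -/
def initial (k : ℕ) : Set X := {x | (D.φ x : ℕ) < k}

/-- A side of the split that belongs to an edge of the caterpillar. -/
def side : Fin (m + 1) ⊕ Fin m → Set X
  | .inl k => D.initial (k + 1)
  | .inr k => {x | (D.φ x : ℕ) = k + 1}

/-- The length of an edge of the caterpillar. -/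
def weight : Fin (m + 1) ⊕ Fin m → ℝ
  | .inl k => D.β k
  | .inr k => D.h (k + 1)

theorem weight_pos (e : Fin (m + 1) ⊕ Fin m) : 0 < D.weight e := by
  rcases e with k | k
  · exact D.β_pos k
  · exact D.h_pos k k.2

include D in
theorem nonempty : Nonempty X := ⟨D.φ.symm 0⟩

theorem exists_val_eq {i : ℕ} (hi : i < m + 2) : ∃ x, (D.φ x : ℕ) = i :=
  ⟨D.φ.symm ⟨i, hi⟩, by simp⟩

theorem side_nonempty (e : Fin (m + 1) ⊕ Fin m) : (D.side e).Nonempty := by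
  rcases e with k | k
  · obtain ⟨x, hx⟩ := D.exists_val_eq (show 0 < m + 2 by omega)
    refine ⟨x, ?_⟩
    change (D.φ x : ℕ) < k + 1
    omega
  · exact D.exists_val_eq (by omega)

theorem side_compl_nonempty (e : Fin (m + 1) ⊕ Fin m) : (D.side e)ᶜ.Nonempty := by
  rcases e with k | k
  · obtain ⟨x, hx⟩ := D.exists_val_eq (show m + 1 < m + 2 by omega)
    refine ⟨x, fun h : (D.φ x : ℕ) < k + 1 => ?_⟩
    omega
  · obtain ⟨x, hx⟩ := D.exists_val_eq (show 0 < m + 2 by omega)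
    refine ⟨x, fun h : (D.φ x : ℕ) = k + 1 => ?_⟩
    omega

theorem indicator_initial (k : ℕ) (x : X) :
    (D.initial k).indicator (1 : X → ℝ) x = if (D.φ x : ℕ) < k then 1 else 0 := by
  classical
  rw [Set.indicator_apply]
  exact if_congr Iff.rfl rfl rfl

theorem indicator_side_inr (k : Fin m) (x : X) :
    (D.side (.inr k)).indicator (1 : X → ℝ) x = if (D.φ x : ℕ) = k + 1 then 1 else 0 := by
  classical
  rw [Set.indicator_apply]
  exact if_congr Iff.rfl rfl rfl

/-- This relation between a leg and the two path edges next to it is a triangle of the fan. -/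
theorem indicator_side_inr_eq_sub (k : Fin m) : (D.side (.inr k)).indicator (1 : X → ℝ) =
    (D.initial (k + 2)).indicator 1 - (D.initial (k + 1)).indicator 1 := by
  ext x
  rw [Pi.sub_apply, indicator_side_inr, indicator_initial, indicator_initial]
  split_ifs <;> first | omega | norm_num

/-- The distance is the weighted sum of the split distances of the edges. -/
theorem dist_eq_sum (x y : X) : dist x y = ∑ e, D.weight e *
    |(D.side e).indicator (1 : X → ℝ) x - (D.side e).indicator 1 y| := by
  rcases eq_or_ne x y with rfl | hxy
  · simp
  wlog hle : D.φ x ≤ D.φ y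
  · rw [dist_comm, this D y x hxy.symm (le_of_not_ge hle)]
    simp only [abs_sub_comm]
  have hne : (D.φ x : ℕ) ≠ D.φ y := fun h => hxy (D.φ.injective (Fin.ext h))
  have hle' : (D.φ x : ℕ) ≤ D.φ y := hle
  have hx := (D.φ x).2
  have hy := (D.φ y).2
  rw [D.dist_eq x y hxy, Fintype.sum_sum_type]
  have hL : ∑ k, D.weight (.inl k) * |(D.side (.inl k)).indicator (1 : X → ℝ) x -
      (D.side (.inl k)).indicator 1 y| =
      |∑ k ∈ Finset.range (D.φ x), D.β k - ∑ k ∈ Finset.range (D.φ y), D.β k| := by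
    let q : ℕ → ℝ := fun i => ∑ k ∈ Finset.range i, D.β k
    have hq : q (D.φ x) ≤ q (D.φ y) :=
      Finset.sum_le_sum_of_subset_of_nonneg (Finset.range_mono hle') fun k _ _ => (D.β_pos k).le
    have h1 := sum_range_sub_mul_cut q (show (D.φ x : ℕ) ≤ m + 1 by omega)
    have h2 := sum_range_sub_mul_cut q (show (D.φ y : ℕ) ≤ m + 1 by omega)
    change _ = |q (D.φ x) - q (D.φ y)|
    rw [abs_of_nonpos (by linarith), show -(q (D.φ x) - q (D.φ y)) =
      (q (D.φ y) - q (m + 1)) - (q (D.φ x) - q (m + 1)) by ring, ← h1, ← h2,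
      ← Finset.sum_sub_distrib, ← Fin.sum_univ_eq_sum_range
      (fun k => (q k - q (k + 1)) * (if (D.φ y : ℕ) < k + 1 then 1 else 0) -
        (q k - q (k + 1)) * (if (D.φ x : ℕ) < k + 1 then 1 else 0))]
    refine Finset.sum_congr rfl fun k _ => ?_
    have hqk : q k - q (k + 1) = -D.β k := by
      simp only [q, Finset.sum_range_succ]
      ring
    rw [hqk, side, weight, indicator_initial, indicator_initial]
    split_ifs <;> first | omega | simp
  have hR : ∑ k, D.weight (.inr k) * |(D.side (.inr k)).indicator (1 : X → ℝ) x -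
      (D.side (.inr k)).indicator 1 y| = D.h (D.φ x) + D.h (D.φ y) := by
    rw [← sum_range_mul_ite_eq D.h_zero D.h_last (show (D.φ x : ℕ) ≤ m + 1 by omega),
      ← sum_range_mul_ite_eq D.h_zero D.h_last (show (D.φ y : ℕ) ≤ m + 1 by omega),
      ← Finset.sum_add_distrib, ← Fin.sum_univ_eq_sum_range
      (fun k => D.h (k + 1) * (if (D.φ x : ℕ) = k + 1 then 1 else 0) +
        D.h (k + 1) * (if (D.φ y : ℕ) = k + 1 then 1 else 0))]
    refine Finset.sum_congr rfl fun k _ => ?_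
    rw [weight, indicator_side_inr, indicator_side_inr]
    -- Both indicators cannot be 1, because the positions of x and y differ.
    split_ifs <;> first | omega | simp
  rw [hL, hR]
  ring

end

section

variable [Fintype X] [PseudoMetricSpace X] (D : CaterpillarData m X)

/-- The generators of the Lipschitz polytope as a zonotope. -/
noncomputable def gen (e : Fin (m + 1) ⊕ Fin m) : X → ℝ := D.weight e • Split.sideVec (D.side e)

theorem gen_sub (e : Fin (m + 1) ⊕ Fin m) (x y : X) : D.gen e x - D.gen e y =
    D.weight e * ((D.side e).indicator 1 x - (D.side e).indicator 1 y) := by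
  have := D.nonempty
  rw [← sideVec_sub, gen, Pi.smul_apply, Pi.smul_apply, smul_eq_mul, smul_eq_mul, mul_sub]

theorem gen_ne_zero (e : Fin (m + 1) ⊕ Fin m) : D.gen e ≠ 0 := by
  intro h
  obtain ⟨x, hx⟩ := D.side_nonempty e
  obtain ⟨y, hy⟩ := D.side_compl_nonempty e
  have h1 := D.gen_sub e x y
  rw [h, Set.indicator_of_mem hx, Set.indicator_of_notMem hy] at h1
  have := D.weight_pos e
  simp at h1
  linarith

theorem sum_combination (t : Fin (m + 1) ⊕ Fin m → ℝ) : ∑ i, (∑ e, t e • D.gen e) i = 0 := by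
  have := D.nonempty
  simp only [Finset.sum_apply, Pi.smul_apply, gen, smul_eq_mul]
  rw [Finset.sum_comm]
  simp only [← Finset.mul_sum, sum_sideVec, mul_zero, Finset.sum_const_zero]

theorem combination_sub (t : Fin (m + 1) ⊕ Fin m → ℝ) (x y : X) :
    (∑ e, t e • D.gen e) x - (∑ e, t e • D.gen e) y = ∑ e, t e * (D.weight e *
      ((D.side e).indicator 1 x - (D.side e).indicator 1 y)) := by
  simp only [Finset.sum_apply, Pi.smul_apply, smul_eq_mul, ← Finset.sum_sub_distrib, ← mul_sub,
    gen_sub]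

theorem zonotope_subset : zonotope D.gen ⊆ lipschitzPolytope X := by
  rintro _ ⟨t, ht, rfl⟩
  refine ⟨D.sum_combination t, fun x y => ?_⟩
  rw [combination_sub, dist_eq_sum D]
  refine Finset.sum_le_sum fun e _ => ?_
  have hw := D.weight_pos e
  refine (le_abs_self _).trans ?_
  rw [abs_mul, abs_mul, abs_of_pos hw]
  exact mul_le_of_le_one_left (by positivity) (ht e)

/-- Every Lipschitz function on the leaves extends to the inner vertices of the caterpillar. -/
theorem exists_extension {x : X → ℝ} (hx : x ∈ lipschitzPolytope X) :
    ∃ z : ℕ → ℝ, (∀ i, |x i - z (D.φ i)| ≤ D.h (D.φ i)) ∧ ∀ k, |z k - z (k + 1)| ≤ D.β k := by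
  have := D.nonempty
  let q : ℕ → ℝ := fun i => ∑ k ∈ Finset.range i, D.β k
  -- McShane extension: the value at path vertex i is the infimum over the leaves y of x y plus the
  -- distance from y to that vertex.
  let F : ℕ → X → ℝ := fun i y => x y + D.h (D.φ y) + |q (D.φ y) - q i|
  have hle : ∀ i y, ⨅ y, F i y ≤ F i y := fun i y => ciInf_le (Set.finite_range _).bddBelow y
  have hh : ∀ i, 0 ≤ D.h (D.φ i) := by
    intro i
    rcases Nat.eq_zero_or_pos (D.φ i : ℕ) with h | h
    · rw [h, D.h_zero]
    · obtain ⟨j, hj⟩ : ∃ j, (D.φ i : ℕ) = j + 1 := ⟨D.φ i - 1, by omega⟩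
      have := (D.φ i).2
      rcases Nat.lt_or_ge j m with hjm | hjm
      · rw [hj]
        exact (D.h_pos j hjm).le
      · have : j = m := by omega
        rw [hj, this, D.h_last]
  have hlip : ∀ i j, ⨅ y, F i y ≤ (⨅ y, F j y) + |q i - q j| := by
    intro i j
    rw [← sub_le_iff_le_add]
    refine le_ciInf fun y => ?_
    have h1 := hle i y
    have h2 := abs_sub_le (q (D.φ y)) (q j) (q i)
    rw [abs_sub_comm (q j)] at h2
    simp only [F] at h1 ⊢
    linarith
  refine ⟨fun i => ⨅ y, F i y, fun i => ?_, fun k => ?_⟩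
  · rw [abs_sub_le_iff]
    constructor
    · rw [sub_le_comm]
      refine le_ciInf fun y => ?_
      -- The formula `dist_eq` covers only distinct leaves. For y = i the bound is the nonnegativity
      -- of the leg length.
      rcases eq_or_ne i y with rfl | hiy
      · have := hh i
        simp only [F, sub_self, abs_zero]
        linarith
      · have h1 := hx.2 i y
        rw [D.dist_eq i y hiy, abs_sub_comm] at h1
        simp only [F, q]
        linarith
    · have h1 := hle (D.φ i) i
      simp only [F, sub_self, abs_zero] at h1 ⊢
      linarith
  · have hq : |q k - q (k + 1)| = D.β k := by
      simp only [q, Finset.sum_range_succ, sub_add_cancel_left, abs_neg, abs_of_pos (D.β_pos k)]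
    have h1 := hlip k (k + 1)
    have h2 := hlip (k + 1) k
    rw [abs_sub_comm (q (k + 1))] at h2
    rw [hq] at h1 h2
    rw [abs_sub_le_iff]
    constructor <;> linarith

theorem subset_zonotope : lipschitzPolytope X ⊆ zonotope D.gen := by
  have := D.nonempty
  intro x hx
  obtain ⟨z, hz, hz'⟩ := D.exists_extension hx
  let b : ℕ → ℝ := fun i => if h : i < m + 2 then x (D.φ.symm ⟨i, h⟩) - z i else 0
  have hb : ∀ i, b (D.φ i) = x i - z (D.φ i) := fun i => by
    simp only [b, dif_pos (D.φ i).2, Fin.eta, Equiv.symm_apply_apply]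
  have hbh : ∀ i < m + 2, |b i| ≤ D.h i := by
    intro i hi
    obtain ⟨y, rfl⟩ := D.exists_val_eq hi
    rw [hb]
    exact hz y
  have hb0 : b 0 = 0 := abs_nonpos_iff.1 (D.h_zero ▸ hbh 0 (by omega))
  have hbm : b (m + 1) = 0 := abs_nonpos_iff.1 (D.h_last ▸ hbh (m + 1) (by omega))
  -- Coefficients are the increments of the extension along the edges, divided by the edge lengths.
  -- The combination telescopes to x up to the constant z (m + 1), which the sum-zero condition
  -- removes.
  let t : Fin (m + 1) ⊕ Fin m → ℝ :=
    Sum.elim (fun k => (z k - z (k + 1)) / D.β k) fun k => b (k + 1) / D.h (k + 1)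
  refine ⟨t, ?_, eq_of_sub_eq_sub hx.1 (D.sum_combination t) fun i j => ?_⟩
  · rintro (k | k)
    · simp only [t, Sum.elim_inl]
      rw [abs_div, abs_of_pos (D.β_pos k)]
      exact div_le_one_of_le₀ (hz' k) (D.β_pos k).le
    · simp only [t, Sum.elim_inr]
      rw [abs_div, abs_of_pos (D.h_pos k k.2)]
      exact div_le_one_of_le₀ (hbh _ (by omega)) (D.h_pos k k.2).le
  · have hval : ∀ i, ∑ e, t e * (D.weight e * (D.side e).indicator 1 i) = x i - z (m + 1) := by
      intro i
      have hi := (D.φ i).2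
      have h1 := sum_range_sub_mul_cut z (show (D.φ i : ℕ) ≤ m + 1 by omega)
      have h2 := sum_range_mul_ite_eq hb0 hbm (show (D.φ i : ℕ) ≤ m + 1 by omega)
      rw [← Fin.sum_univ_eq_sum_range
        (fun k => (z k - z (k + 1)) * (if (D.φ i : ℕ) < k + 1 then 1 else 0))] at h1
      rw [hb, ← Fin.sum_univ_eq_sum_range
        (fun k => b (k + 1) * (if (D.φ i : ℕ) = k + 1 then 1 else 0))] at h2
      have h3 : x i - z (m + 1) = (z (D.φ i) - z (m + 1)) + (x i - z (D.φ i)) := by ring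
      rw [h3, ← h1, ← h2, Fintype.sum_sum_type]
      congr 1
      · refine Finset.sum_congr rfl fun k _ => ?_
        rw [side, indicator_initial, weight, ← mul_assoc]
        simp only [t, Sum.elim_inl]
        rw [div_mul_cancel₀ _ (D.β_pos k).ne']
      · refine Finset.sum_congr rfl fun k _ => ?_
        rw [indicator_side_inr, weight, ← mul_assoc]
        simp only [t, Sum.elim_inr]
        rw [div_mul_cancel₀ _ (D.h_pos k k.2).ne']
    rw [combination_sub]
    simp only [mul_sub, Finset.sum_sub_distrib, hval]
    ring

theorem lipschitzPolytope_eq_zonotope : lipschitzPolytope X = zonotope D.gen :=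
  D.subset_zonotope.antisymm D.zonotope_subset

/-- Every potential on the vertices of the fan comes from a vector with coordinate sum `0`. -/
theorem exists_vector_of_potential (t : ℕ → ℝ) (ht0 : t 0 = 0) :
    ∃ c : X → ℝ, ∑ x, c x = 0 ∧
      ∀ k ≤ m + 1, c ⬝ᵥ (D.initial k).indicator 1 = t k := by
  -- Truncation makes s vanish at m + 2 as well as at 0, so the increments, used as coordinates, sum
  -- to 0.
  let s : ℕ → ℝ := fun k => if k ≤ m + 1 then t k else 0
  let f : ℕ → ℝ := fun i => s (i + 1) - s i
  have hsum : ∀ F : ℕ → ℝ, ∑ x, F (D.φ x) = ∑ i ∈ Finset.range (m + 2), F i := by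
    intro F
    rw [← Fin.sum_univ_eq_sum_range]
    exact D.φ.sum_comp fun i => F i
  refine ⟨fun x => f (D.φ x), ?_, fun k hk => ?_⟩
  · rw [hsum f, Finset.sum_range_sub]
    simp [s, ht0]
  · simp only [dotProduct, indicator_initial]
    rw [hsum fun i => f i * if i < k then 1 else 0]
    simp only [mul_ite, mul_one, mul_zero]
    rw [← Finset.sum_filter]
    have hfilter : (Finset.range (m + 2)).filter (fun i => i < k) = Finset.range k := by
      ext i
      simp only [Finset.mem_filter, Finset.mem_range]
      omega
    rw [hfilter, Finset.sum_range_sub]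
    simp [s, ht0, hk]

/-- On each triangle the second spoke is the first spoke plus the rim edge, so two equal signs force
the third. Conversely, every admissible pattern comes from a potential, and the positive weights do
not change signs. -/
theorem regionSigns_gen : regionSigns D.gen =
    {ε | ∀ k : Fin m, ε (.inl k.castSucc) = ε (.inr k) →
      ε (.inl k.succ) = ε (.inl k.castSucc)} := by
  have := D.nonempty
  ext ε
  constructor
  · rintro ⟨l, hl⟩ k h
    have h1 := hl (.inl k.castSucc)
    have h2 := hl (.inr k)
    have h3 := hl (.inl k.succ)
    have hsub : Split.sideVec (D.side (.inr k)) =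
        Split.sideVec (D.side (.inl k.succ)) - Split.sideVec (D.side (.inl k.castSucc)) := by
      refine eq_of_sub_eq_sub (sum_sideVec _) ?_ fun i j => ?_
      · simp [Finset.sum_sub_distrib, sum_sideVec]
      · rw [sideVec_sub, indicator_side_inr_eq_sub]
        simp only [sideVec_apply, Pi.sub_apply, side, Fin.val_succ, Fin.val_castSucc]
        ring
    have hpos : ∀ {s w a : ℝ}, 0 < w → 0 < s * (w * a) → 0 < s * a := by
      intro s w a hw h
      have h' : 0 < w * (s * a) := by linarith
      exact pos_of_mul_pos_right h' hw.le
    simp only [gen, map_smul, smul_eq_mul] at h1 h2 h3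
    replace h1 := hpos (D.weight_pos _) h1
    replace h2 := hpos (D.weight_pos _) h2
    replace h3 := hpos (D.weight_pos _) h3
    rw [hsub, map_sub, ← h] at h2
    revert h1 h2 h3
    generalize ε (.inl k.castSucc) = x, ε (.inl k.succ) = y
    intro h1 h2 h3
    cases x <;> cases y <;> simp [boolSign] at h1 h2 h3 ⊢ <;> linarith
  · intro hε
    -- The signs do not constrain t at the hub, so its value there can be reset to 0.
    obtain ⟨t, ht1, ht2⟩ := exists_potential_of_fanOrientation hε
    obtain ⟨c, hc0, hc⟩ := D.exists_vector_of_potential (fun k => if k = 0 then 0 else t k) rfl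
    have hinit : ∀ k ≤ m, c ⬝ᵥ (D.initial (k + 1)).indicator 1 = t (k + 1) := by
      intro k hk
      rw [hc (k + 1) (by omega), if_neg (by omega)]
    refine ⟨dotFunctional c, ?_⟩
    have key : ∀ e, 0 < boolSign (ε e) * c ⬝ᵥ (D.side e).indicator 1 := by
      rintro (k | k)
      · rw [side, hinit k (by omega)]
        exact ht1 k
      · rw [indicator_side_inr_eq_sub, dotProduct_sub, hinit k (by omega),
          show (k : ℕ) + 2 = (k + 1) + 1 from rfl, hinit (k + 1) (by omega)]
        exact ht2 k
    intro e
    rw [gen, map_smul, dotFunctional_apply, dotProduct_sideVec_of_sum_eq_zero hc0, smul_eq_mul,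
      mul_left_comm]
    exact mul_pos (D.weight_pos e) (key e)

include D in
theorem numVertices_lipschitzPolytope : numVertices (lipschitzPolytope X) = 2 * 3 ^ m := by
  rw [numVertices_eq_ncard_exposedPoints, D.lipschitzPolytope_eq_zonotope,
    ncard_exposedPoints_zonotope D.gen_ne_zero, D.regionSigns_gen, ncard_setOf_fanOrientation]

end

end CaterpillarData

/-! ### The arrangement of a caterpillar metric -/

section Functional

variable {V W ι : Type*} [AddCommGroup W] [Module ℝ W] {s : V → Module.Dual ℝ W}

theorem dual_sub_ne_zero (hs : ∀ t : V → ℝ, ∃ x : W, ∀ u v, (s u - s v) x = t u - t v) {u v : V}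
    (h : u ≠ v) : s v - s u ≠ 0 := by
  classical
  intro h0
  obtain ⟨x, hx⟩ := hs (Pi.single v 1)
  have h1 := hx v u
  rw [h0, Pi.single_eq_same, Pi.single_eq_of_ne h] at h1
  simp at h1

/-- If edge j has an end point off edge i, the indicator of that point is a potential constant on i
but not on j. This makes the hyperplanes distinct, so that they can serve as a ground set. -/
theorem ker_dual_sub_injective
    (hs : ∀ t : V → ℝ, ∃ x : W, ∀ u v, (s u - s v) x = t u - t v) {a b : ι → V}
    (hinj : Function.Injective fun i => s(a i, b i)) (hne : ∀ i, a i ≠ b i) :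
    Function.Injective fun i => LinearMap.ker (s (b i) - s (a i)) := by
  classical
  intro i j hij
  have hij' : LinearMap.ker (s (b i) - s (a i)) = LinearMap.ker (s (b j) - s (a j)) := hij
  by_contra hcon
  have hedge : s(a i, b i) ≠ s(a j, b j) := fun h => hcon (hinj h)
  have key : ∀ t : V → ℝ, t (b i) = t (a i) → t (b j) = t (a j) := by
    intro t ht
    obtain ⟨x, hx⟩ := hs t
    have h1 : x ∈ LinearMap.ker (s (b i) - s (a i)) := by
      rw [LinearMap.mem_ker, hx, ht, sub_self]
    have h2 : x ∈ LinearMap.ker (s (b j) - s (a j)) := hij' ▸ h1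
    rw [LinearMap.mem_ker, hx] at h2
    exact sub_eq_zero.1 h2
  by_cases hb : b j = a i ∨ b j = b i
  · by_cases ha : a j = a i ∨ a j = b i
    · apply hedge
      have := hne j
      rw [Sym2.eq_iff]
      rcases hb with hb | hb <;> rcases ha with ha | ha <;> simp_all
    · push Not at ha
      have h1 := key (Pi.single (a j) 1)
        (by rw [Pi.single_eq_of_ne ha.1.symm, Pi.single_eq_of_ne ha.2.symm])
      rw [Pi.single_eq_same, Pi.single_eq_of_ne (hne j).symm] at h1
      exact zero_ne_one h1
  · push Not at hb
    have h1 := key (Pi.single (b j) 1)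
      (by rw [Pi.single_eq_of_ne hb.1.symm, Pi.single_eq_of_ne hb.2.symm])
    rw [Pi.single_eq_same, Pi.single_eq_of_ne (hne j)] at h1
    exact one_ne_zero h1

end Functional

theorem Split.mem_hyperplane_iff {X : Type*} [Fintype X] [Nonempty X] {σ : Split X} {A : Set X}
    (hA : σ.IsSide A) (x : X → ℝ) : x ∈ σ.hyperplane ↔ x ⬝ᵥ Split.sideVec A = 0 := by
  constructor
  · intro h
    exact h _ (subset_convexHull ℝ _ ⟨A, hA, rfl⟩)
  · intro h
    have hsub : σ.segment ⊆ LinearMap.ker (dotFunctional x).toLinearMap := by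
      refine convexHull_min ?_ (Submodule.convex _)
      rintro _ ⟨B, hB, rfl⟩
      change x ⬝ᵥ Split.sideVec B = 0
      rcases hA.eq_or_eq_compl hB with rfl | rfl
      · exact h
      · have hneg : Split.sideVec Aᶜ = -Split.sideVec A := by
          rw [Split.sideVec, Split.sideVec, compl_compl, neg_sub]
        rw [hneg, dotProduct_neg, h, neg_zero]
    exact fun y hy => hsub hy

/-- The first end point of an edge of the fan. -/
def fanTail {m : ℕ} : Fin (m + 1) ⊕ Fin m → Fin (m + 2)
  | .inl _ => 0
  | .inr k => k.castSucc.succ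

/-- The second end point of an edge of the fan. -/
def fanHead {m : ℕ} : Fin (m + 1) ⊕ Fin m → Fin (m + 2)
  | .inl k => k.succ
  | .inr k => k.succ.succ

theorem fanTail_lt_fanHead {m : ℕ} (e : Fin (m + 1) ⊕ Fin m) : fanTail e < fanHead e := by
  rcases e with k | k
  · exact Fin.succ_pos k
  · exact Fin.succ_lt_succ_iff.2 (Fin.castSucc_lt_succ)

theorem fanEdge_injective {m : ℕ} :
    Function.Injective fun e : Fin (m + 1) ⊕ Fin m => s(fanTail e, fanHead e) := by
  intro e f h
  have he := fanTail_lt_fanHead e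
  have hf := fanTail_lt_fanHead f
  rcases Sym2.eq_iff.1 h with ⟨h1, h2⟩ | ⟨h1, h2⟩
  · rcases e with k | k <;> rcases f with j | j
    · exact congrArg _ (Fin.succ_injective _ h2)
    · exact (Fin.succ_ne_zero j.castSucc h1.symm).elim
    · exact (Fin.succ_ne_zero k.castSucc h1).elim
    · exact congrArg _ (Fin.succ_injective _ (Fin.succ_injective _ h2))
  · rw [h1, h2] at he
    exact (lt_asymm he hf).elim

theorem range_fanEdge (m : ℕ) : Set.range (fun e : Fin (m + 1) ⊕ Fin m =>
    s(fanTail e, fanHead e)) = (fanGraph (m + 2)).edgeSet := by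
  ext e
  constructor
  · rintro ⟨e, rfl⟩
    rw [SimpleGraph.mem_edgeSet, fanGraph, SimpleGraph.fromRel_adj]
    refine ⟨(fanTail_lt_fanHead e).ne, Or.inl ?_⟩
    rcases e with k | k
    · exact Or.inl rfl
    · exact Or.inr rfl
  · induction e using Sym2.ind with
    | _ u v =>
      have key : ∀ u v : Fin (m + 2), u ≠ v → (u.val = 0 ∨ u.val + 1 = v.val) →
          s(u, v) ∈ Set.range fun e : Fin (m + 1) ⊕ Fin m => s(fanTail e, fanHead e) := by
        intro u v huv h
        by_cases hu : u.val = 0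
        · obtain rfl : u = 0 := Fin.ext hu
          obtain ⟨k, rfl⟩ := Fin.exists_succ_eq.2 huv.symm
          exact ⟨.inl k, rfl⟩
        · have h' := h.resolve_left hu
          have hv := v.2
          refine ⟨.inr ⟨u - 1, by omega⟩, ?_⟩
          have h1 : fanTail (.inr ⟨u - 1, by omega⟩ : Fin (m + 1) ⊕ Fin m) = u :=
            Fin.ext (by simp [fanTail]; omega)
          have h2 : fanHead (.inr ⟨u - 1, by omega⟩ : Fin (m + 1) ⊕ Fin m) = v :=
            Fin.ext (by simp [fanHead]; omega)
          simp only [h1, h2]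
      rw [SimpleGraph.mem_edgeSet, fanGraph, SimpleGraph.fromRel_adj]
      rintro ⟨huv, h | h⟩
      · exact key u v huv h
      · rw [Sym2.eq_swap]
        exact key v u huv.symm h

namespace CaterpillarData

variable {m : ℕ} {X : Type*}

/-! ### The split system of the caterpillar -/

section

variable [PseudoMetricSpace X] (D : CaterpillarData m X)

/-- The split that belongs to an edge of the caterpillar. -/
def split (e : Fin (m + 1) ⊕ Fin m) : Split X :=
  ⟨s(D.side e, (D.side e)ᶜ), D.side e, D.side_nonempty e, D.side_compl_nonempty e, rfl⟩

theorem isSide_split (e : Fin (m + 1) ⊕ Fin m) : (D.split e).IsSide (D.side e) :=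
  Sym2.mem_mk_left _ _

theorem split_delta (e : Fin (m + 1) ⊕ Fin m) (x y : X) : (D.split e).delta x y =
    |(D.side e).indicator (1 : X → ℝ) x - (D.side e).indicator 1 y| := by
  classical
  rw [Split.delta_eq (D.isSide_split e), Set.indicator_apply, Set.indicator_apply]
  by_cases hx : x ∈ D.side e <;> by_cases hy : y ∈ D.side e <;> simp [hx, hy]

theorem split_injective : Function.Injective D.split := by
  classical
  intro e f h
  obtain ⟨o, ho⟩ := D.exists_val_eq (show 0 < m + 2 by omega)
  -- A split determines its side only up to complement, so sides are compared relative to the first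
  -- leaf o. The last leaf then tells path edges, which separate it from o, from legs, which do not.
  have key : ∀ y, (o ∈ D.side e ↔ y ∈ D.side e) ↔ (o ∈ D.side f ↔ y ∈ D.side f) := by
    intro y
    have h1 : (D.split e).delta o y = (D.split f).delta o y := by rw [h]
    rw [Split.delta_eq (D.isSide_split e), Split.delta_eq (D.isSide_split f)] at h1
    split_ifs at h1 <;> simp_all
  have hl : ∀ (k : Fin (m + 1)) y, y ∈ D.side (.inl k) ↔ (D.φ y : ℕ) < k + 1 :=
    fun _ _ => Iff.rfl
  have hr : ∀ (k : Fin m) y, y ∈ D.side (.inr k) ↔ (D.φ y : ℕ) = k + 1 := fun _ _ => Iff.rfl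
  obtain ⟨y, hy⟩ := D.exists_val_eq (show m + 1 < m + 2 by omega)
  have hkey := key y
  rcases e with k | k <;> rcases f with j | j
  · obtain ⟨x, hx⟩ := D.exists_val_eq (show k.val + 1 < m + 2 by omega)
    obtain ⟨z, hz⟩ := D.exists_val_eq (show j.val + 1 < m + 2 by omega)
    have h1 := key x
    have h2 := key z
    simp [hl, ho, hx, hz] at h1 h2
    exact congrArg _ (Fin.ext (by omega))
  · simp only [hl, hr, ho, hy] at hkey
    omega
  · simp only [hl, hr, ho, hy] at hkey
    omega
  · obtain ⟨x, hx⟩ := D.exists_val_eq (show k.val + 1 < m + 2 by omega)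
    have h1 := key x
    simp [hr, ho, hx] at h1
    exact congrArg _ (Fin.ext h1)

theorem compatible_split (e f : Fin (m + 1) ⊕ Fin m) :
    (D.split e).Compatible (D.split f) := by
  have hll : ∀ k j : Fin (m + 1), k ≤ j → D.side (.inl k) ∩ (D.side (.inl j))ᶜ = ∅ := by
    intro k j hkj
    have hkj' : (k : ℕ) ≤ j := hkj
    refine Set.eq_empty_iff_forall_notMem.2 ?_
    rintro x ⟨h1 : (D.φ x : ℕ) < k + 1, h2 : ¬ (D.φ x : ℕ) < j + 1⟩
    omega
  have hlr : ∀ (k : Fin (m + 1)) (j : Fin m), D.side (.inl k) ∩ D.side (.inr j) = ∅ ∨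
      (D.side (.inl k))ᶜ ∩ D.side (.inr j) = ∅ := by
    intro k j
    rcases Nat.lt_or_ge j k with h | h
    · right
      refine Set.eq_empty_iff_forall_notMem.2 ?_
      rintro x ⟨h1 : ¬ (D.φ x : ℕ) < k + 1, h2 : (D.φ x : ℕ) = j + 1⟩
      omega
    · left
      refine Set.eq_empty_iff_forall_notMem.2 ?_
      rintro x ⟨h1 : (D.φ x : ℕ) < k + 1, h2 : (D.φ x : ℕ) = j + 1⟩
      omega
  have hs := D.isSide_split
  rcases e with k | k <;> rcases f with j | j
  · rcases le_total k j with h | h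
    · exact ⟨_, _, hs _, (hs _).compl, hll k j h⟩
    · exact ⟨_, _, (hs _).compl, hs _, by rw [Set.inter_comm]; exact hll j k h⟩
  · rcases hlr k j with h | h
    · exact ⟨_, _, hs _, hs _, h⟩
    · exact ⟨_, _, (hs _).compl, hs _, h⟩
  · rcases hlr j k with h | h
    · exact ⟨_, _, hs _, hs _, by rw [Set.inter_comm]; exact h⟩
    · exact ⟨_, _, hs _, (hs _).compl, by rw [Set.inter_comm]; exact h⟩
  · rcases eq_or_ne k j with rfl | h
    · exact ⟨_, _, hs _, (hs _).compl, Set.inter_compl_self _⟩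
    · refine ⟨_, _, hs _, hs _, Set.eq_empty_iff_forall_notMem.2 ?_⟩
      rintro x ⟨h1 : (D.φ x : ℕ) = k + 1, h2 : (D.φ x : ℕ) = j + 1⟩
      exact h (Fin.ext (by omega))

open Classical in
/-- The splits of all the edges of the caterpillar. -/
noncomputable def splits : Finset (Split X) := Finset.univ.image D.split

theorem split_mem_splits (e : Fin (m + 1) ⊕ Fin m) : D.split e ∈ D.splits := by
  classical
  exact Finset.mem_image_of_mem _ (Finset.mem_univ e)

theorem isSplitDecomposition : IsSplitDecomposition X D.splits := by
  classical
  have hmem : ∀ σ ∈ D.splits, ∃ e, D.split e = σ := by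
    intro σ hσ
    obtain ⟨e, -, he⟩ := Finset.mem_image.1 hσ
    exact ⟨e, he⟩
  refine ⟨fun σ hσ τ hτ => ?_, Function.extend D.split D.weight 0, fun σ hσ => ?_, fun x y => ?_⟩
  · obtain ⟨e, rfl⟩ := hmem σ hσ
    obtain ⟨f, rfl⟩ := hmem τ hτ
    exact D.compatible_split e f
  · obtain ⟨e, rfl⟩ := hmem σ hσ
    rw [D.split_injective.extend_apply]
    exact D.weight_pos e
  · rw [splits, Finset.sum_image D.split_injective.injOn, D.dist_eq_sum]
    refine Finset.sum_congr rfl fun e _ => ?_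
    rw [D.split_injective.extend_apply, split_delta]

end

/-! ### The arrangement as a graphic arrangement -/

section

variable [Fintype X] [MetricSpace X] (D : CaterpillarData m X)

/-- Distinct points have positive distance and are thus separated by some split, so the second
condition on V(S) is void. -/
theorem mem_splitSpace {x : X → ℝ} : x ∈ splitSpace D.splits ↔ ∑ i, x i = 0 := by
  refine ⟨fun h => h.1, fun h => ⟨h, fun i j hij => ?_⟩⟩
  have hd : dist i j = 0 := by
    rw [D.dist_eq_sum]
    refine Finset.sum_eq_zero fun e _ => ?_
    rw [← split_delta, hij _ (D.split_mem_splits e), mul_zero]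
  rw [dist_eq_zero.1 hd]

/-- The sum of the coordinates in front of a position. -/
noncomputable def partialSum (k : Fin (m + 2)) : Module.Dual ℝ (splitSpace D.splits) :=
  (dotFunctional ((D.initial k).indicator 1)).toLinearMap ∘ₗ (splitSpace D.splits).subtype

theorem partialSum_apply (k : Fin (m + 2)) (x : splitSpace D.splits) :
    D.partialSum k x = x.1 ⬝ᵥ (D.initial k).indicator 1 :=
  dotProduct_comm _ _

theorem exists_potential (t : Fin (m + 2) → ℝ) : ∃ x : splitSpace D.splits, ∀ u v,
    (D.partialSum u - D.partialSum v) x = t u - t v := by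
  obtain ⟨c, hc0, hc⟩ := D.exists_vector_of_potential
    (fun k => if h : k < m + 2 then t ⟨k, h⟩ - t 0 else 0) (by simp)
  refine ⟨⟨c, D.mem_splitSpace.2 hc0⟩, fun u v => ?_⟩
  have h : ∀ u : Fin (m + 2), c ⬝ᵥ (D.initial u).indicator 1 = t u - t 0 := fun u => by
    rw [hc u (by omega), dif_pos u.2]
  rw [LinearMap.sub_apply, partialSum_apply, partialSum_apply, h, h]
  ring

/-- The hub is the empty initial segment, so spokes give initial segments and rim edges give single
leaves. -/
theorem partialSum_sub_apply (e : Fin (m + 1) ⊕ Fin m) (x : splitSpace D.splits) :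
    (D.partialSum (fanHead e) - D.partialSum (fanTail e)) x =
      x.1 ⬝ᵥ (D.side e).indicator 1 := by
  rw [LinearMap.sub_apply, partialSum_apply, partialSum_apply, ← dotProduct_sub]
  congr 1
  rcases e with k | k
  · have h : D.initial (fanTail (m := m) (.inl k)) = ∅ :=
      Set.eq_empty_iff_forall_notMem.2 fun x hx => Nat.not_lt_zero _ hx
    rw [h, Set.indicator_empty', sub_zero]
    rfl
  · rw [indicator_side_inr_eq_sub]
    rfl

theorem ker_partialSum_sub (e : Fin (m + 1) ⊕ Fin m) :
    LinearMap.ker (D.partialSum (fanHead e) - D.partialSum (fanTail e)) =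
      (D.split e).hyperplane.comap (splitSpace D.splits).subtype := by
  have := D.nonempty
  ext x
  rw [LinearMap.mem_ker, partialSum_sub_apply, Submodule.mem_comap,
    Split.mem_hyperplane_iff (D.isSide_split e), Submodule.subtype_apply,
    dotProduct_sideVec_of_sum_eq_zero (D.mem_splitSpace.1 x.2)]

theorem matroidIso : MatroidIso (arrangementMatroid (splitArrangement D.splits))
    (cycleMatroid (fanGraph (m + 2))) := by
  classical
  have hne : ∀ e : Fin (m + 1) ⊕ Fin m, fanTail e ≠ fanHead e := fun e =>
    (fanTail_lt_fanHead e).ne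
  have hinj := ker_dual_sub_injective D.exists_potential fanEdge_injective hne
  have hrange : Set.range (fun e => LinearMap.ker
      (D.partialSum (fanHead e) - D.partialSum (fanTail e))) =
      (splitArrangement D.splits : Set (Submodule ℝ (splitSpace D.splits))) := by
    ext H
    constructor
    · rintro ⟨e, rfl⟩
      exact Finset.mem_coe.2 (Finset.mem_image.2
        ⟨D.split e, D.split_mem_splits e, (D.ker_partialSum_sub e).symm⟩)
    · intro hH
      obtain ⟨σ, hσ, rfl⟩ := Finset.mem_image.1 (Finset.mem_coe.1 hH)
      obtain ⟨e, -, rfl⟩ := Finset.mem_image.1 hσ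
      exact ⟨e, D.ker_partialSum_sub e⟩
  refine matroidIso_of_index hinj fanEdge_injective hrange (range_fanEdge m) fun I => ?_
  rw [indep_arrangementMatroid_iff (fun e => dual_sub_ne_zero D.exists_potential (hne e))
    (fun e => by rw [← Finset.mem_coe, ← hrange]; exact ⟨e, rfl⟩) hinj,
    linearIndepOn_sub_iff_isAcyclic (fun t => ?_) fanEdge_injective hne (Set.toFinite I)]
  · have h : (cycleMatroid (fanGraph (m + 2))).Indep
        ((fun e => s(fanTail e, fanHead e)) '' I) ↔
        (fun e => s(fanTail e, fanHead e)) '' I ⊆ (fanGraph (m + 2)).edgeSet ∧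
          (SimpleGraph.fromEdgeSet ((fun e => s(fanTail e, fanHead e)) '' I)).IsAcyclic := Iff.rfl
    rw [h, ← range_fanEdge]
    exact (and_iff_right (Set.image_subset_range _ _)).symm
  · obtain ⟨x, hx⟩ := D.exists_potential t
    -- The vectors compared are themselves functionals, so the functional realising a potential is
    -- evaluation at a point.
    exact ⟨Module.Dual.eval ℝ _ x, hx⟩

end

end CaterpillarData

theorem mainTheorem6 (n : ℕ) (hn : 3 ≤ n) (X : Type*) [Fintype X] [MetricSpace X]
    (hX : IsCaterpillarMetric n X) :
    (∃ S : Finset (Split X),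
      IsSplitDecomposition X S ∧
      (∀ S' : Finset (Split X), IsSplitDecomposition X S' → S' = S) ∧
      MatroidIso (arrangementMatroid (splitArrangement S)) (cycleMatroid (fanGraph n))) ∧
    numVertices (lipschitzPolytope X) = 2 * 3 ^ (n - 2) ∧
    numFacets (fundamentalPolytope X) = 2 * 3 ^ (n - 2) := by
  obtain ⟨m, rfl⟩ : ∃ m, n = m + 2 := ⟨n - 2, by omega⟩
  obtain ⟨D⟩ := hX.nonempty_data (by omega)
  have : Nontrivial X := D.φ.nontrivial
  refine ⟨⟨D.splits, D.isSplitDecomposition, fun S' hS' => D.isSplitDecomposition.unique hS',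
    D.matroidIso⟩, D.numVertices_lipschitzPolytope, ?_⟩
  rw [numFacets_fundamentalPolytope]
  exact D.numVertices_lipschitzPolytope
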